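/- \textbf{Notation.} For integers $r\ge 1$, $m\ge 0$ let $\mathsf H_m^{(r)}=\sum_{j=1}^m j^{-r}$ and $\mathsf H_m=\mathsf H_m^{(1)}$. For $z\in(0,1]$ the generalized polylogarithms (GPLs) are $G(\underbrace{0,\dots,0}_{n};z)=\frac{\log^n z}{n!}$ for $n\ge 0$ (so the empty word gives $1$), and $$G(\alpha_1,\dots,\alpha_n;z)=\int_0^z\frac{G(\alpha_2,\dots,\alpha_n;t)}{t-\alpha_1}\,dt\qquad\text{if }(\alpha_1,\dots,\alpha_n)\in\mathbb C^n\smallsetminus\{(0,\dots,0)\}.$$ At $z=1$, if $\alpha_1=1$, the value $G(1,\alpha_2,\dots,\alpha_n;1)$ is understood as a finite part: the constant term $P(0)$ of the polynomial $P$ such that $G(1,\alpha_2,\dots,\alpha_n;1-\varepsilon)=P(\log\varepsilon)+o(1)$ as $\varepsilon\to0^+$. For $S,T\subset\mathbb C$ and integers $1\le m\le n$ put $$\mathfrak G^{(1)}_{n;m}[S;T]=\sum_{j=m}^{n}\operatorname{Span}_{\mathbb Q}\bigl\{G(\alpha_1,\dots,\alpha_n;1)\;:\;\alpha_j\in T,\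 \alpha_\ell\in\{0,1\}\cup S\text{ for all }\ell\neq j\bigr\}.$$ For $x\in\mathbb C$ let $\sigma_{\ell,m}(x)=\frac{(-1)^\ell x+i(-1)^m\sqrt{3x^2-4}}{2}$ for $\ell,m\in\{0,1\}$ and $$S_x=\{x,-x,\sigma_{0,0}(x),\sigma_{0,1}(x),\sigma_{1,0}(x),\sigma_{1,1}(x)\}.$$ \textbf{Theorem.} Let $x\in\mathbb C$ satisfy $|x(1-x^2)|>\frac{2}{3\sqrt3}$ and let $r\ge1$ be an integer. (1) If $(a_k)_{k\ge1}$ is one of the sequences $\frac1k$, $\;-\mathsf H_k+2\mathsf H_{2k}+\mathsf H_{3k}-2\mathsf H_{6k}$, $\;\mathsf H_{2k-1}+\mathsf H_{3k}-2\mathsf H_{6k}+2\log 2$, then the following series converges absolutely and $$\sum_{k=1}^\infty\frac{a_k\binom{2k}{k}}{k^{r+1}\binom{3k}{k}\binom{6k}{3k}}\left[\frac{2^2}{x(1-x^2)}\right]^{2k}\in\mathfrak G^{(1)}_{r+2;\,r+1}[\{-1\};S_x].$$ (2) For every integer $M\ge0$ and all positive integers $r_1,\dots,r_M$, with $w=r+1+\sum_{j=1}^M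 r_j$, the following series converges absolutely and $$\sum_{k=1}^\infty\left[\prod_{j=1}^M\mathsf H_k^{(r_j)}\right]\frac{\binom{2k}{k}}{k^{r+1}\binom{3k}{k}\binom{6k}{3k}}\left[\frac{2^2}{x(1-x^2)}\right]^{2k}\in\mathfrak G^{(1)}_{w;\,w}\bigl[\{-1\}\cup S_x;S_x\bigr].$$ -/

import Mathlib

noncomputable section

namespace GPLSeries

open Filter Topology

/-- The generalized harmonic number `H_m^{(r)} = ∑_{j=1}^m 1 / j^r`. -/
def genHarmonic (r m : ℕ) : ℝ := ∑ j ∈ Finset.Icc 1 m, 1 / (j : ℝ) ^ r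

/-- The harmonic number `H_m = H_m^{(1)}`. -/
def harm (m : ℕ) : ℝ := genHarmonic 1 m

open Classical in
/-- The generalized polylogarithm `G(α₁, …, αₙ; z)` for a real endpoint `z`, where the straight
path from `0` to `z` is a real interval: `G(0, …, 0; z) = log(z)^n / n!` (so `1` for the empty
word), and otherwise `G(α₁, …, αₙ; z) = ∫_0^z G(α₂, …, αₙ; t) / (t - α₁) dt`.
Divergent values at the endpoint `z = 1` are treated in `gplOne`. -/
def gpl : List ℂ → ℝ → ℂ
  | [], _ => 1
  | α :: αs, z =>
    if ∀ β ∈ α :: αs, β = 0 then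
      Complex.log (z : ℂ) ^ (αs.length + 1) / ((αs.length + 1).factorial : ℂ)
    else
      ∫ t in (0 : ℝ)..z, gpl αs t / ((t : ℂ) - α)

/-- `f ε = P (log ε) + o(1)` as `ε → 0⁺`: the logarithmic expansion of `f` at `0⁺`. -/
def HasLogExpansion (f : ℝ → ℂ) (P : Polynomial ℂ) : Prop :=
  Tendsto (fun ε : ℝ => f ε - P.eval ((Real.log ε : ℝ) : ℂ)) (𝓝[>] 0) (𝓝 0)

/-- The polynomial of a logarithmic expansion is unique. -/
theorem HasLogExpansion.unique {f : ℝ → ℂ} {P Q : Polynomial ℂ}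
    (hP : HasLogExpansion f P) (hQ : HasLogExpansion f Q) : P = Q := by
  have h : Tendsto (fun ε : ℝ => (P - Q).eval ((Real.log ε : ℝ) : ℂ)) (𝓝[>] 0) (𝓝 0) := by
    have h1 := Tendsto.sub hQ hP
    simp only [sub_zero] at h1
    refine h1.congr fun ε => ?_
    simp only [Polynomial.eval_sub]
    ring
  have hlog : Tendsto (fun ε : ℝ => ‖((Real.log ε : ℝ) : ℂ)‖) (𝓝[>] 0) atTop := by
    simp only [Complex.norm_real, Real.norm_eq_abs]
    exact tendsto_abs_atBot_atTop.comp Real.tendsto_log_nhdsGT_zero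
  by_cases hd : 0 < (P - Q).degree
  · have h2 := Polynomial.tendsto_norm_atTop (P - Q) hd hlog
    exact absurd h.norm (not_tendsto_nhds_of_tendsto_atTop h2 _)
  · have hc := Polynomial.eq_C_of_degree_le_zero (not_lt.mp hd)
    rw [hc] at h
    simp only [Polynomial.eval_C] at h
    have h3 := tendsto_nhds_unique h tendsto_const_nhds
    rw [← h3, Polynomial.C_0] at hc
    exact sub_eq_zero.mp hc

open Classical in
/-- The finite part at `ε → 0⁺`: the constant term of the logarithmic expansion. -/
def finitePart (f : ℝ → ℂ) : ℂ :=
  if h : ∃ P : Polynomial ℂ, HasLogExpansion f P then h.choose.coeff 0 else 0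

theorem finitePart_eq {f : ℝ → ℂ} {P : Polynomial ℂ} (h : HasLogExpansion f P) :
    finitePart f = P.coeff 0 := by
  have hex : ∃ P : Polynomial ℂ, HasLogExpansion f P := ⟨P, h⟩
  rw [finitePart, dif_pos hex, hex.choose_spec.unique h]

open Classical in
/-- `G(α₁, …, αₙ; 1)`, where the divergent values (those with `α₁ = 1`) are replaced by the finite
part of `G(α₁, …, αₙ; 1 - ε)` as `ε → 0⁺`, so that for instance `G(1; 1) = 0`. -/
def gplOne (αs : List ℂ) : ℂ :=
  if αs.head? = some 1 then finitePart (fun ε => gpl αs (1 - ε)) else gpl αs 1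

/-- The `ℚ`-vector space `𝔊^{(1)}_{n; m}[S; T]`: the sum over the positions `j` with `m ≤ j ≤ n` of
the spans of the numbers `G(α₁, …, αₙ; 1)` with `α_j ∈ T` and all other letters in `{0, 1} ∪ S`.
The position `j` corresponds to the index `j - 1` of `Fin n`. -/
def gplSpace (n m : ℕ) (S T : Set ℂ) : Submodule ℚ ℂ :=
  ⨆ (j : Fin n) (_ : m ≤ (j : ℕ) + 1),
    Submodule.span ℚ {y : ℂ | ∃ α : Fin n → ℂ,
      (∀ l, l ≠ j → α l ∈ ({0, 1} : Set ℂ) ∪ S) ∧ α j ∈ T ∧ y = gplOne (List.ofFn α)}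

/-- `σ_{ℓ,m}(x) = ((-1)^ℓ x + i (-1)^m √(3x² - 4)) / 2`, with the principal square root. -/
def sigma (l m : ℕ) (x : ℂ) : ℂ :=
  ((-1) ^ l * x + Complex.I * (-1) ^ m * (3 * x ^ 2 - 4) ^ (1 / 2 : ℂ)) / 2

/-- The set `{x, -x, σ_{0,0}(x), σ_{0,1}(x), σ_{1,0}(x), σ_{1,1}(x)}`. -/
def letters (x : ℂ) : Set ℂ :=
  {x, -x, sigma 0 0 x, sigma 0 1 x, sigma 1 0 x, sigma 1 1 x}

/-- The summand `a_k C(2k,k) / (k^{r+1} C(3k,k) C(6k,3k)) [2² / (x(1-x²))]^{2k}`, for `k ≥ 1`. -/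
def summand (a : ℕ → ℝ) (r : ℕ) (x : ℂ) (k : ℕ) : ℂ :=
  (a k : ℂ) * ((2 * k).choose k : ℂ) /
      ((k : ℂ) ^ (r + 1) * ((3 * k).choose k : ℂ) * ((6 * k).choose (3 * k) : ℂ)) *
    (2 ^ 2 / (x * (1 - x ^ 2))) ^ (2 * k)

/-- The series `∑_{k ≥ 1} summand a r x k` converges absolutely and its sum lies in `V`. -/
def SeriesMem (a : ℕ → ℝ) (r : ℕ) (x : ℂ) (V : Submodule ℚ ℂ) : Prop :=
  Summable (fun k : ℕ => summand a r x (k + 1)) ∧ ∑' k : ℕ, summand a r x (k + 1) ∈ V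

end GPLSeries

end

noncomputable section

namespace GPLSeries

open Filter Topology Set MeasureTheory Asymptotics

section

/-! ### Integrals of functions on `(0, 1)` with power singularities at the endpoints -/

/-! Put `p(t) = t(1 - t²)` and `z(t) = (p(t)/p(x))²`, which is `ratio x t`. Up to elementary
factors, the quotient of binomials in the series is a Beta integral: for `k ≥ 1` the summand is `4
c_k ∫₀¹ (1 - t²)^(2k-1) t^(2k) dt / p(x)^(2k)`, where `c_k = a_k / k^r` (`summand_eq`). Summing
under the integral turns the series into `∫₀¹ (∑ c_k z(t)^k) · 4/(1 - t²) dt`, and `4/(1 - t²) =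
2/(t+1) - 2/(t-1)` is a combination of GPL kernels (`seriesMem_of_betaInt`). On `[0,1]` the maximum
of `p` is `2/(3√3)`, so the hypothesis on `x` keeps `|z|` uniformly below 1 and all letters off
`[0,1]`.

It remains to see that `∑ c_k z(t)^k` is a combination of GPLs in `t`. Both `d log z = 2 (1/t +
1/(t-1) + 1/(t+1)) dt` and `d log(1 - z) = ∑ dt/(t - s)`, over the six roots `s` of `p(s)² = p(x)²`,
have only simple poles. Starting from `-log(1 - z) = ∑ z^k/k`, dividing coefficients by `k`
integrates against the first form (`IsGplSeries.div_nat`), and taking strict partial sums before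
dividing integrates against the second (`IsGplSeries.psum`). Products of harmonic numbers are
reached by telescoping (`isGplSeries_prod_genHarmonic`).

The other two sequences in part (1) come from differentiating the Beta integral in its parameters,
that is, from the weights `2 log t` and `log(1 - t²)` (`betaInt_log`, `betaInt_log_one_sub`). These
are GPLs of weight one; a shuffle absorbs them and pushes the letter of `S_x` at most one place away
from the end (`gpl_singleton_mul_mem`).

At `t = 1` single GPLs may diverge like powers of a logarithm although the total converges.
Logarithmic expansions add linearly and are unique, so the limit is the same combination of finite
parts (`gpl_expansion`, `limit_mem_span`). -/

theorem intervalIntegrable_of_isBigO {h : ℝ → ℂ} (hc : ContinuousOn h (Ioo 0 1))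
    (hO : h =O[𝓝[>] 0] fun t : ℝ => t ^ (-(1 / 2) : ℝ)) {z : ℝ} (hz : z ∈ Ioo (0 : ℝ) 1) :
    IntervalIntegrable h volume 0 z := by
  have hloc : IntegrableAtFilter h (𝓝[>] (0 : ℝ)) volume := by
    refine hO.integrableAtFilter ?_ ?_
    · exact ⟨Ioo 0 1, Ioo_mem_nhdsGT one_pos, hc.aestronglyMeasurable measurableSet_Ioo⟩
    · refine ⟨Ioc 0 1, Ioc_mem_nhdsGT one_pos, ?_⟩
      have := intervalIntegral.intervalIntegrable_rpow' (a := 0) (b := 1)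
        (r := -(1 / 2)) (by norm_num)
      exact (intervalIntegrable_iff_integrableOn_Ioc_of_le zero_le_one).1 this
  obtain ⟨s, hs, hsi⟩ := hloc
  obtain ⟨δ, hδ, hδs⟩ := (mem_nhdsGT_iff_exists_Ioc_subset).1 hs
  rw [intervalIntegrable_iff_integrableOn_Ioc_of_le hz.1.le]
  have hδ0 : 0 < δ := hδ
  have h2 : IntegrableOn h (Icc (min δ z) z) := by
    refine ContinuousOn.integrableOn_Icc (hc.mono ?_)
    intro t ht
    exact ⟨lt_of_lt_of_le (lt_min hδ0 hz.1) ht.1, lt_of_le_of_lt ht.2 hz.2⟩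
  refine ((hsi.mono_set hδs).union h2).mono_set ?_
  intro t ht
  rcases le_total t δ with h | h
  · exact Or.inl ⟨ht.1, h⟩
  · exact Or.inr ⟨(min_le_left _ _).trans h, ht.2⟩

theorem integral_isBigO {h : ℝ → ℂ}
    (hO : h =O[𝓝[>] 0] fun t : ℝ => t ^ (-(1 / 2) : ℝ)) :
    (fun z : ℝ => ∫ t in (0 : ℝ)..z, h t) =O[𝓝[>] 0] fun z : ℝ => z ^ (1 / 2 : ℝ) := by
  obtain ⟨C, hC⟩ := hO.bound
  obtain ⟨δ, hδ, hδs⟩ := (mem_nhdsGT_iff_exists_Ioc_subset).1 hC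
  refine IsBigO.of_bound (C * 2) ?_
  filter_upwards [Ioc_mem_nhdsGT hδ] with z hz
  have hz0 : 0 < z := hz.1
  have h1 : ‖∫ t in (0 : ℝ)..z, h t‖ ≤ ∫ t in (0 : ℝ)..z, C * t ^ (-(1 / 2) : ℝ) := by
    refine intervalIntegral.norm_integral_le_of_norm_le hz.1.le ?_ ?_
    · refine Eventually.of_forall fun t ht => ?_
      have := hδs ⟨ht.1, ht.2.trans hz.2⟩
      simp only [Set.mem_ofPred_eq, Real.norm_eq_abs, abs_of_nonneg (Real.rpow_nonneg ht.1.le _)]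
        at this
      exact this
    · exact (intervalIntegral.intervalIntegrable_rpow' (by norm_num)).const_mul _
  refine h1.trans (le_of_eq ?_)
  rw [intervalIntegral.integral_const_mul, integral_rpow (Or.inl (by norm_num)),
    Real.norm_eq_abs, abs_of_nonneg (Real.rpow_nonneg hz0.le _)]
  norm_num
  ring

theorem integral_hasDerivAt {h : ℝ → ℂ} (hc : ContinuousOn h (Ioo 0 1))
    (hi : ∀ z ∈ Ioo (0 : ℝ) 1, IntervalIntegrable h volume 0 z) {z : ℝ}
    (hz : z ∈ Ioo (0 : ℝ) 1) :
    HasDerivAt (fun z : ℝ => ∫ t in (0 : ℝ)..z, h t) (h z) z := by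
  refine intervalIntegral.integral_hasDerivAt_right (hi z hz) ?_ ?_
  · exact hc.stronglyMeasurableAtFilter isOpen_Ioo z hz
  · exact hc.continuousAt (isOpen_Ioo.mem_nhds hz)

theorem tendsto_rpow_half : Tendsto (fun z : ℝ => z ^ (1 / 2 : ℝ)) (𝓝[>] 0) (𝓝 0) := by
  have h : ContinuousAt (fun z : ℝ => z ^ (1 / 2 : ℝ)) 0 :=
    Real.continuousAt_rpow_const _ _ (Or.inr (by norm_num))
  have h2 := h.tendsto
  rw [Real.zero_rpow (by norm_num)] at h2
  exact h2.mono_left nhdsWithin_le_nhds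

theorem tendsto_zero_of_isBigO {F : ℝ → ℂ}
    (hF : F =O[𝓝[>] 0] fun z : ℝ => z ^ (1 / 2 : ℝ)) : Tendsto F (𝓝[>] 0) (𝓝 0) :=
  hF.trans_tendsto tendsto_rpow_half

theorem tendsto_one_sub : Tendsto (fun ε : ℝ => 1 - ε) (𝓝[>] 0) (𝓝[<] 1) := by
  refine tendsto_nhdsWithin_iff.2 ⟨?_, ?_⟩
  · have : Tendsto (fun ε : ℝ => 1 - ε) (𝓝 0) (𝓝 (1 - 0)) := by
      exact (continuous_const.sub continuous_id).tendsto 0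
    rw [sub_zero] at this
    exact this.mono_left nhdsWithin_le_nhds
  · filter_upwards [self_mem_nhdsWithin] with ε hε
    simp only [mem_Iio]
    have : (0 : ℝ) < ε := hε
    linarith

theorem one_sub_mem {t : ℝ} (ht : t ∈ Ioo (0 : ℝ) 1) : 1 - t ∈ Ioo (0 : ℝ) 1 :=
  ⟨by linarith [ht.2], by linarith [ht.1]⟩

/-- Functions on `(0, 1)` with the same derivative differ by a constant. -/
theorem exists_sub_const {F G F' : ℝ → ℂ} (hF : ∀ t ∈ Ioo (0 : ℝ) 1, HasDerivAt F (F' t) t)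
    (hG : ∀ t ∈ Ioo (0 : ℝ) 1, HasDerivAt G (F' t) t) :
    ∃ c : ℂ, ∀ t ∈ Ioo (0 : ℝ) 1, F t = G t + c := by
  obtain ⟨c, hc⟩ := isOpen_Ioo.exists_is_const_of_deriv_eq_zero (𝕜 := ℝ)
    (f := fun t => F t - G t) (convex_Ioo (0 : ℝ) 1).isPreconnected
    (fun t ht => ((hF t ht).sub (hG t ht)).differentiableAt.differentiableWithinAt)
    (fun t ht => by
      have := ((hF t ht).sub (hG t ht)).deriv
      rw [sub_self] at this
      exact this)
  exact ⟨c, fun t ht => by rw [← hc t ht]; ring⟩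

theorem eqOn_of_hasDerivAt {F G F' : ℝ → ℂ} (hF : ∀ t ∈ Ioo (0 : ℝ) 1, HasDerivAt F (F' t) t)
    (hG : ∀ t ∈ Ioo (0 : ℝ) 1, HasDerivAt G (F' t) t) (hF0 : Tendsto F (𝓝[>] 0) (𝓝 0))
    (hG0 : Tendsto G (𝓝[>] 0) (𝓝 0)) : EqOn F G (Ioo 0 1) := by
  obtain ⟨c, hc⟩ := exists_sub_const hF hG
  have h1 : Tendsto F (𝓝[>] 0) (𝓝 (0 + c)) := by
    refine (hG0.add_const c).congr' ?_
    filter_upwards [Ioo_mem_nhdsGT (zero_lt_one' ℝ)] with t ht using (hc t ht).symm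
  have h2 := tendsto_nhds_unique hF0 h1
  intro t ht
  rw [hc t ht, show c = 0 by simpa using h2.symm, add_zero]

/-- A function on `(0, 1)` whose derivative is `O((1 - t)^(-1/2))` at `1` converges there. -/
theorem exists_limit_of_hasDerivAt {K k : ℝ → ℂ} (hk : ContinuousOn k (Ioo 0 1))
    (hK : ∀ t ∈ Ioo (0 : ℝ) 1, HasDerivAt K (k t) t)
    (hO : (fun u : ℝ => k (1 - u)) =O[𝓝[>] 0] fun t : ℝ => t ^ (-(1 / 2) : ℝ)) :
    ∃ L : ℂ, (fun ε : ℝ => K (1 - ε) - L) =O[𝓝[>] 0] fun ε : ℝ => ε ^ (1 / 2 : ℝ) := by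
  have hc : ContinuousOn (fun u : ℝ => k (1 - u)) (Ioo 0 1) :=
    hk.comp (by fun_prop) fun t ht => one_sub_mem ht
  have hc' : ContinuousOn (fun u : ℝ => -k (1 - u)) (Ioo 0 1) := hc.neg
  have hO' : (fun u : ℝ => -k (1 - u)) =O[𝓝[>] 0] fun t : ℝ => t ^ (-(1 / 2) : ℝ) :=
    hO.neg_left
  have h1 := fun t ht => integral_hasDerivAt hc'
    (fun z hz => intervalIntegrable_of_isBigO hc' hO' hz) (z := t) ht
  have h2 : ∀ t ∈ Ioo (0 : ℝ) 1, HasDerivAt (fun ε : ℝ => K (1 - ε)) (-k (1 - t)) t := by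
    intro t ht
    have := (hK (1 - t) (one_sub_mem ht)).scomp t ((hasDerivAt_id t).const_sub 1)
    simpa [Function.comp_def] using this
  obtain ⟨c, hc⟩ := exists_sub_const h2 h1
  refine ⟨c, (integral_isBigO hO').congr' ?_ (EventuallyEq.refl _ _)⟩
  filter_upwards [Ioo_mem_nhdsGT (zero_lt_one' ℝ)] with t ht
  rw [hc t ht]; ring

/-! ### Logarithms -/

/-- The exponents `±1/2` and `-1/4` make the estimates self-reproducing: logarithms cost `-1/4`, a
regular kernel is allowed another `-1/4`, the resulting `-1/2` is integrable, and its primitive has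
order `1/2`, enough to pay for a later pole of order one. -/
theorem log_pow_isBigO (n : ℕ) :
    (fun t : ℝ => ((Real.log t : ℝ) : ℂ) ^ n) =O[𝓝[>] 0] fun t : ℝ => t ^ (-(1 / 4) : ℝ) := by
  have h := (isLittleO_abs_log_rpow_rpow_nhdsGT_zero (s := -(1 / 4)) (n : ℝ)
    (by norm_num)).isBigO
  refine (IsBigO.of_norm_left (h.congr_left fun t => ?_))
  rw [norm_pow, Complex.norm_real, Real.norm_eq_abs, Real.rpow_natCast]

theorem eval_log_isBigO (P : Polynomial ℂ) :
    (fun t : ℝ => P.eval ((Real.log t : ℝ) : ℂ)) =O[𝓝[>] 0] fun t : ℝ => t ^ (-(1 / 4) : ℝ) := by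
  induction P using Polynomial.induction_on' with
  | add p q hp hq => simpa only [Polynomial.eval_add] using hp.add hq
  | monomial n a =>
    simpa only [Polynomial.eval_monomial] using (log_pow_isBigO n).const_mul_left a

theorem rpow_isBigO {a b : ℝ} (hab : b ≤ a) :
    (fun t : ℝ => t ^ a) =O[𝓝[>] 0] fun t : ℝ => t ^ b := by
  refine IsBigO.of_bound 1 ?_
  filter_upwards [Ioo_mem_nhdsGT (zero_lt_one' ℝ)] with t ht
  rw [one_mul, Real.norm_eq_abs, Real.norm_eq_abs, abs_of_nonneg (Real.rpow_nonneg ht.1.le _),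
    abs_of_nonneg (Real.rpow_nonneg ht.1.le _)]
  exact Real.rpow_le_rpow_of_exponent_ge ht.1 ht.2.le hab

theorem isBigO_rpow_of_tendsto {F : ℝ → ℂ} {c : ℂ} (h : Tendsto F (𝓝[>] 0) (𝓝 c)) {b : ℝ}
    (hb : b ≤ 0) : F =O[𝓝[>] 0] fun t : ℝ => t ^ b := by
  have h1 : F =O[𝓝[>] 0] fun t : ℝ => t ^ (0 : ℝ) := by
    simpa using h.isBigO_one ℝ
  exact h1.trans (rpow_isBigO hb)

theorem inv_isBigO : (fun t : ℝ => ((t : ℂ))⁻¹) =O[𝓝[>] 0] fun t : ℝ => t ^ (-1 : ℝ) := by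
  refine IsBigO.of_bound 1 ?_
  filter_upwards [self_mem_nhdsWithin] with t ht
  rw [Real.rpow_neg_one, norm_inv, norm_inv, Complex.norm_real, one_mul]

theorem rpow_mul_isBigO {F G : ℝ → ℂ} {a b : ℝ} (hF : F =O[𝓝[>] 0] fun t : ℝ => t ^ a)
    (hG : G =O[𝓝[>] 0] fun t : ℝ => t ^ b) :
    (fun t => F t * G t) =O[𝓝[>] 0] fun t : ℝ => t ^ (a + b) := by
  refine (hF.mul hG).congr' (EventuallyEq.refl _ _) ?_
  filter_upwards [self_mem_nhdsWithin] with t ht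
  exact (Real.rpow_add ht _ _).symm

/-- The letters for which the kernel `1 / (t - α)` is regular on `(0, 1)`. -/
def Admissible (α : ℂ) : Prop := ∀ t ∈ Ioo (0 : ℝ) 1, (t : ℂ) ≠ α

theorem Admissible.sub_ne {α : ℂ} (h : Admissible α) {t : ℝ} (ht : t ∈ Ioo (0 : ℝ) 1) :
    (t : ℂ) - α ≠ 0 := sub_ne_zero.2 (h t ht)

theorem Admissible.continuousOn {α : ℂ} (h : Admissible α) :
    ContinuousOn (fun t : ℝ => ((t : ℂ) - α)⁻¹) (Ioo 0 1) :=
  ContinuousOn.inv₀ (by fun_prop) fun _ ht => h.sub_ne ht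

theorem kernel_tendsto_zero {α : ℂ} (h : α ≠ 0) :
    Tendsto (fun t : ℝ => ((t : ℂ) - α)⁻¹) (𝓝[>] 0) (𝓝 (((0 : ℝ) : ℂ) - α)⁻¹) := by
  refine Tendsto.mono_left (ContinuousAt.tendsto (f := fun t : ℝ => ((t : ℂ) - α)⁻¹) ?_)
    nhdsWithin_le_nhds
  exact ContinuousAt.inv₀ (by fun_prop) (by simpa using h)

theorem kernel_tendsto_one {α : ℂ} (h : α ≠ 1) :
    Tendsto (fun u : ℝ => (((1 - u : ℝ) : ℂ) - α)⁻¹) (𝓝[>] 0)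
      (𝓝 (((1 - 0 : ℝ) : ℂ) - α)⁻¹) := by
  refine Tendsto.mono_left
    (ContinuousAt.tendsto (f := fun t : ℝ => (((1 - t : ℝ) : ℂ) - α)⁻¹) ?_) nhdsWithin_le_nhds
  exact ContinuousAt.inv₀ (by fun_prop) (by simpa [sub_eq_zero] using h.symm)

/-! ### Generalized polylogarithms on `(0, 1)` -/

theorem gpl_of_forall_eq_zero {w : List ℂ} (h : ∀ β ∈ w, β = 0) (z : ℝ) :
    gpl w z = Complex.log (z : ℂ) ^ w.length / (w.length.factorial : ℂ) := by
  cases w with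
  | nil => simp [gpl]
  | cons α αs => rw [gpl, if_pos h, List.length_cons]

theorem gpl_cons {α : ℂ} {w : List ℂ} (h : ¬ ∀ β ∈ α :: w, β = 0) (z : ℝ) :
    gpl (α :: w) z = ∫ t in (0 : ℝ)..z, gpl w t / ((t : ℂ) - α) := by
  rw [gpl, if_neg h]

theorem gpl_zeros_isBigO {w : List ℂ} (h : ∀ β ∈ w, β = 0) :
    gpl w =O[𝓝[>] 0] fun t : ℝ => t ^ (-(1 / 4) : ℝ) := by
  refine ((log_pow_isBigO w.length).const_mul_left (w.length.factorial : ℂ)⁻¹).congr' ?_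
    (EventuallyEq.refl _ _)
  filter_upwards [self_mem_nhdsWithin] with t ht
  rw [gpl_of_forall_eq_zero h, Complex.ofReal_log (le_of_lt ht), div_eq_inv_mul]

theorem gpl_zeros_hasDerivAt {w : List ℂ} (h : ∀ β ∈ w, β = 0) {t : ℝ} (ht : 0 < t) :
    HasDerivAt (gpl (0 :: w)) (gpl w t / ((t : ℂ) - 0)) t := by
  have h0 : ∀ β ∈ (0 : ℂ) :: w, β = 0 := by simpa using h
  have hlog : HasDerivAt (fun t : ℝ => Complex.log (t : ℂ)) ((t : ℂ)⁻¹) t := by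
    exact (Complex.hasDerivAt_log (z := (t : ℂ)) (by simp [Complex.slitPlane, ht])).comp_ofReal
  have h1 := (hlog.fun_pow (w.length + 1)).div_const ((w.length + 1).factorial : ℂ)
  have h2 : gpl (0 :: w) = fun t : ℝ =>
      Complex.log (t : ℂ) ^ (w.length + 1) / ((w.length + 1).factorial : ℂ) := by
    funext z
    rw [gpl_of_forall_eq_zero h0, List.length_cons]
  rw [h2]
  refine h1.congr_deriv ?_
  rw [gpl_of_forall_eq_zero h, Nat.factorial_succ]
  have : (w.length.factorial : ℂ) ≠ 0 := by exact_mod_cast Nat.factorial_ne_zero _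
  have h3 : ((w.length : ℂ) + 1) ≠ 0 := by exact_mod_cast Nat.succ_ne_zero w.length
  have h4 : (t : ℂ) ≠ 0 := by exact_mod_cast ht.ne'
  push_cast
  field_simp
  simp

/-- Behaviour at `0`, and derivative on `(0, 1)`, of a generalized polylogarithm. -/
theorem gpl_zero_and_continuousOn (w : List ℂ) (hw : ∀ β ∈ w, Admissible β) :
    ContinuousOn (gpl w) (Ioo 0 1) ∧ (gpl w =O[𝓝[>] 0] fun t : ℝ => t ^ (-(1 / 4) : ℝ)) ∧
      ((¬ ∀ β ∈ w, β = 0) → gpl w =O[𝓝[>] 0] fun t : ℝ => t ^ (1 / 2 : ℝ)) ∧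
      (∀ α w', w = α :: w' → (fun t : ℝ => gpl w' t / ((t : ℂ) - α)) =O[𝓝[>] 0]
        (fun t : ℝ => t ^ (-(1 / 2) : ℝ)) ∨ ∀ β ∈ w, β = 0) ∧
      (∀ α w', w = α :: w' → ∀ t ∈ Ioo (0 : ℝ) 1,
        HasDerivAt (gpl w) (gpl w' t / ((t : ℂ) - α)) t) := by
  induction w with
  | nil =>
    refine ⟨?_, ?_, by simp, by simp, by simp⟩
    · exact (continuousOn_const (c := (1 : ℂ))).congr fun t _ => by simp [gpl]
    · exact gpl_zeros_isBigO (by simp)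
  | cons α w ih =>
    obtain ⟨ihc, ih4, ih2, -, -⟩ := ih fun β hβ => hw β (List.mem_cons_of_mem _ hβ)
    have hα : Admissible α := hw α List.mem_cons_self
    by_cases hz : ∀ β ∈ α :: w, β = 0
    · have hα0 : α = 0 := hz α List.mem_cons_self
      subst hα0
      have hd : ∀ t ∈ Ioo (0 : ℝ) 1, HasDerivAt (gpl (0 :: w)) (gpl w t / ((t : ℂ) - 0)) t :=
        fun t ht => gpl_zeros_hasDerivAt (fun β hβ => hz β (List.mem_cons_of_mem _ hβ)) ht.1
      refine ⟨fun t ht => (hd t ht).continuousAt.continuousWithinAt, gpl_zeros_isBigO hz,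
        fun h => absurd hz h, fun _ _ _ => Or.inr hz, ?_⟩
      rintro β w' h
      obtain ⟨rfl, rfl⟩ := List.cons_eq_cons.1 h
      exact hd
    · have hO : (fun t : ℝ => gpl w t / ((t : ℂ) - α)) =O[𝓝[>] 0]
          (fun t : ℝ => t ^ (-(1 / 2) : ℝ)) := by
        by_cases hα0 : α = 0
        · subst hα0
          -- A leading 0 leaves the nonzero letter in the tail, so the tail is `O(t^(1/2))` and
          -- offsets the pole `1/t`.
          have hw0 : ¬ ∀ β ∈ w, β = 0 := fun h => hz (by simpa using h)
          have := rpow_mul_isBigO (ih2 hw0) inv_isBigO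
          norm_num at this
          simpa [div_eq_mul_inv] using this
        · have h1 := isBigO_rpow_of_tendsto (kernel_tendsto_zero hα0) (b := -(1 / 4))
            (by norm_num)
          have := rpow_mul_isBigO ih4 h1
          norm_num at this
          simpa [div_eq_mul_inv] using this
      have hc : ContinuousOn (fun t : ℝ => gpl w t / ((t : ℂ) - α)) (Ioo 0 1) :=
        (ihc.mul hα.continuousOn).congr fun t _ => div_eq_mul_inv _ _
      have hfun : gpl (α :: w) = fun z : ℝ => ∫ t in (0 : ℝ)..z, gpl w t / ((t : ℂ) - α) := by
        funext z; exact gpl_cons hz z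
      have hd : ∀ t ∈ Ioo (0 : ℝ) 1, HasDerivAt (gpl (α :: w)) (gpl w t / ((t : ℂ) - α)) t := by
        intro t ht
        rw [hfun]
        exact integral_hasDerivAt hc (fun z hz => intervalIntegrable_of_isBigO hc hO hz) ht
      have hO2 : gpl (α :: w) =O[𝓝[>] 0] fun t : ℝ => t ^ (1 / 2 : ℝ) := by
        rw [hfun]; exact integral_isBigO hO
      refine ⟨fun t ht => (hd t ht).continuousAt.continuousWithinAt,
        hO2.trans (rpow_isBigO (by norm_num)), fun _ => hO2, ?_, ?_⟩
      · rintro β w' h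
        obtain ⟨rfl, rfl⟩ := List.cons_eq_cons.1 h
        exact Or.inl hO
      · rintro β w' h
        obtain ⟨rfl, rfl⟩ := List.cons_eq_cons.1 h
        exact hd

theorem gpl_continuousOn {w : List ℂ} (hw : ∀ β ∈ w, Admissible β) :
    ContinuousOn (gpl w) (Ioo 0 1) :=
  (gpl_zero_and_continuousOn w hw).1

theorem gpl_isBigO {w : List ℂ} (hw : ∀ β ∈ w, Admissible β) :
    gpl w =O[𝓝[>] 0] fun t : ℝ => t ^ (-(1 / 4) : ℝ) :=
  (gpl_zero_and_continuousOn w hw).2.1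

theorem gpl_isBigO_half {w : List ℂ} (hw : ∀ β ∈ w, Admissible β) (h0 : ¬ ∀ β ∈ w, β = 0) :
    gpl w =O[𝓝[>] 0] fun t : ℝ => t ^ (1 / 2 : ℝ) :=
  (gpl_zero_and_continuousOn w hw).2.2.1 h0

theorem gpl_hasDerivAt {α : ℂ} {w : List ℂ} (hw : ∀ β ∈ α :: w, Admissible β) {t : ℝ}
    (ht : t ∈ Ioo (0 : ℝ) 1) : HasDerivAt (gpl (α :: w)) (gpl w t / ((t : ℂ) - α)) t :=
  (gpl_zero_and_continuousOn _ hw).2.2.2.2 α w rfl t ht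

theorem gpl_tendsto_zero {w : List ℂ} (hw : ∀ β ∈ w, Admissible β) (h0 : ¬ ∀ β ∈ w, β = 0) :
    Tendsto (gpl w) (𝓝[>] 0) (𝓝 0) :=
  tendsto_zero_of_isBigO (gpl_isBigO_half hw h0)

/-! ### Expansions at `1` -/

/-- Since `d log(1 - t) = dt/(t - 1)`, integrating a polynomial in `log(1 - t)` against the kernel
of the letter 1 is polynomial antidifferentiation. -/
theorem exists_antideriv (P : Polynomial ℂ) :
    ∃ Q : Polynomial ℂ, Q.derivative = P ∧ Q.coeff 0 = 0 := by
  induction P using Polynomial.induction_on' with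
  | add p q hp hq =>
    obtain ⟨P, hP, hP0⟩ := hp
    obtain ⟨Q, hQ, hQ0⟩ := hq
    exact ⟨P + Q, by simp [hP, hQ], by simp [hP0, hQ0]⟩
  | monomial n a =>
    refine ⟨Polynomial.monomial (n + 1) (a / (n + 1)), ?_, ?_⟩
    · rw [Polynomial.derivative_monomial]
      have : ((n : ℂ) + 1) ≠ 0 := by exact_mod_cast Nat.succ_ne_zero n
      simp [this]
    · simp [Polynomial.coeff_monomial]

theorem hasLogExpansion_of_isBigO {f : ℝ → ℂ} {P : Polynomial ℂ}
    (h : (fun ε : ℝ => f ε - P.eval ((Real.log ε : ℝ) : ℂ)) =O[𝓝[>] 0]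
      fun ε : ℝ => ε ^ (1 / 2 : ℝ)) : HasLogExpansion f P :=
  tendsto_zero_of_isBigO h

/-- The value at `1` of a convergent generalized polylogarithm is its limit. -/
theorem gpl_one_eq_limit {α : ℂ} {w : List ℂ} (hw : ∀ β ∈ α :: w, Admissible β)
    (hO : (fun u : ℝ => gpl w (1 - u) / (((1 - u : ℝ) : ℂ) - α)) =O[𝓝[>] 0]
      fun t : ℝ => t ^ (-(1 / 2) : ℝ)) {L : ℂ}
    (hL : Tendsto (fun ε : ℝ => gpl (α :: w) (1 - ε)) (𝓝[>] 0) (𝓝 L)) :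
    gpl (α :: w) 1 = L := by
  by_cases hz : ∀ β ∈ α :: w, β = 0
  · refine tendsto_nhds_unique (f := fun ε : ℝ => gpl (α :: w) (1 - ε))
      (Tendsto.mono_left ?_ nhdsWithin_le_nhds) hL
    have : ContinuousAt (fun ε : ℝ => gpl (α :: w) (1 - ε)) 0 := by
      have hd := gpl_zeros_hasDerivAt (w := w) (fun β hβ => hz β (List.mem_cons_of_mem _ hβ))
        (t := 1) one_pos
      have hα0 : α = 0 := hz α List.mem_cons_self
      subst hα0
      exact ContinuousAt.comp (f := fun ε : ℝ => 1 - ε) (g := gpl (0 :: w))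
        (by simpa using hd.continuousAt) (by fun_prop)
    simpa [ContinuousAt] using this
  · have hw' : ∀ β ∈ w, Admissible β := fun β hβ => hw β (List.mem_cons_of_mem _ hβ)
    have hα : Admissible α := hw α List.mem_cons_self
    set h : ℝ → ℂ := fun t : ℝ => gpl w t / ((t : ℂ) - α) with hh
    have hc : ContinuousOn h (Ioo 0 1) :=
      ((gpl_continuousOn hw').mul hα.continuousOn).congr fun t _ => by
        simp [hh, div_eq_mul_inv]
    have hc1 : ContinuousOn (fun u => h (1 - u)) (Ioo 0 1) :=
      hc.comp (by fun_prop) fun t ht => one_sub_mem ht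
    have h0 := ((gpl_zero_and_continuousOn _ hw).2.2.2.1 α w rfl).resolve_right hz
    have hhalf : (1 / 2 : ℝ) ∈ Ioo (0 : ℝ) 1 := by norm_num
    have i1 := intervalIntegrable_of_isBigO hc h0 hhalf
    have i2 := intervalIntegrable_of_isBigO hc1 hO hhalf
    have i3 : IntervalIntegrable h volume 0 1 := by
      have := (i2.comp_sub_left 1).symm
      norm_num at this
      norm_num at i1
      exact i1.trans this
    have hcont := intervalIntegral.continuousOn_primitive_interval' i3 (a := 0) (by simp)
    rw [gpl_cons hz]
    refine tendsto_nhds_unique (f := fun ε : ℝ => gpl (α :: w) (1 - ε)) ?_ hL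
    have h1 := (hcont 1 (by simp)).tendsto
    have h2 : Tendsto (fun ε : ℝ => 1 - ε) (𝓝[>] 0) (𝓝[uIcc 0 1] 1) := by
      refine tendsto_nhdsWithin_iff.2 ⟨tendsto_one_sub.mono_right nhdsWithin_le_nhds, ?_⟩
      filter_upwards [Ioo_mem_nhdsGT (zero_lt_one' ℝ)] with t ht
      rw [uIcc_of_le zero_le_one]
      exact Ioo_subset_Icc_self (one_sub_mem ht)
    refine (h1.comp h2).congr fun ε => ?_
    rw [gpl_cons hz]; rfl

/-- The logarithmic expansion at `1` of a generalized polylogarithm; its constant term is the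
regularized value. -/
theorem gpl_expansion (w : List ℂ) (hw : ∀ β ∈ w, Admissible β) :
    ∃ P : Polynomial ℂ, ((fun ε : ℝ => gpl w (1 - ε) - P.eval ((Real.log ε : ℝ) : ℂ))
      =O[𝓝[>] 0] fun ε : ℝ => ε ^ (1 / 2 : ℝ)) ∧ P.coeff 0 = gplOne w := by
  induction w with
  | nil =>
    refine ⟨1, ?_, by simp [gplOne, gpl]⟩
    simpa [gpl] using isBigO_zero _ _
  | cons α w ih =>
    have hw' : ∀ β ∈ w, Admissible β := fun β hβ => hw β (List.mem_cons_of_mem _ hβ)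
    have hα : Admissible α := hw α List.mem_cons_self
    obtain ⟨P, hP, -⟩ := ih hw'
    have hgc := gpl_continuousOn hw'
    by_cases h1 : α = 1
    · subst h1
      obtain ⟨Q, hQ, hQ0⟩ := exists_antideriv P
      have hlog : ∀ t ∈ Ioo (0 : ℝ) 1, HasDerivAt (fun t : ℝ => ((Real.log (1 - t) : ℝ) : ℂ))
          (((t : ℂ) - 1)⁻¹) t := by
        intro t ht
        have h1 := (((hasDerivAt_id t).const_sub 1).log
          (by simpa using (one_sub_mem ht).1.ne')).ofReal_comp
        refine h1.congr_deriv ?_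
        simp only [id]
        push_cast
        rw [← neg_sub, neg_div_neg_eq, one_div]
      have hlogc : ContinuousOn (fun t : ℝ => ((Real.log (1 - t) : ℝ) : ℂ)) (Ioo 0 1) :=
        fun t ht => (hlog t ht).continuousAt.continuousWithinAt
      -- Subtracting `Q(log(1 - t))` removes the logarithmic part of the integrand. What is left is
      -- the `O((1 - t)^(1/2))` remainder of the tail times a simple pole, which is integrable at 1.
      have hK : ∀ t ∈ Ioo (0 : ℝ) 1,
          HasDerivAt (fun t : ℝ => gpl (1 :: w) t - Q.eval ((Real.log (1 - t) : ℝ) : ℂ))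
            ((gpl w t - P.eval ((Real.log (1 - t) : ℝ) : ℂ)) * ((t : ℂ) - 1)⁻¹) t := by
        intro t ht
        have h2 := (Q.hasDerivAt ((Real.log (1 - t) : ℝ) : ℂ)).comp t (hlog t ht)
        have h3 := (gpl_hasDerivAt hw ht).sub h2
        refine h3.congr_deriv ?_
        rw [hQ]; ring
      have hkc : ContinuousOn (fun t : ℝ =>
          (gpl w t - P.eval ((Real.log (1 - t) : ℝ) : ℂ)) * ((t : ℂ) - 1)⁻¹) (Ioo 0 1) := by
        refine ContinuousOn.mul (hgc.sub ?_) hα.continuousOn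
        exact P.continuous.comp_continuousOn hlogc
      have hkO : (fun u : ℝ => (gpl w (1 - u) - P.eval ((Real.log (1 - (1 - u)) : ℝ) : ℂ)) *
          (((1 - u : ℝ) : ℂ) - 1)⁻¹) =O[𝓝[>] 0] fun t : ℝ => t ^ (-(1 / 2) : ℝ) := by
        have h2 := rpow_mul_isBigO hP inv_isBigO
        norm_num at h2
        refine (h2.neg_left.congr_left fun u => ?_).trans (rpow_isBigO (by norm_num))
        push_cast
        rw [sub_sub_cancel, sub_sub_cancel_left, ← neg_inv]
        ring
      obtain ⟨L, hL⟩ := exists_limit_of_hasDerivAt hkc hK hkO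
      have hexp : (fun ε : ℝ => gpl (1 :: w) (1 - ε) -
          (Q + Polynomial.C L).eval ((Real.log ε : ℝ) : ℂ)) =O[𝓝[>] 0]
            fun ε : ℝ => ε ^ (1 / 2 : ℝ) := by
        refine hL.congr_left fun ε => ?_
        simp only [sub_sub_cancel, Polynomial.eval_add, Polynomial.eval_C]
        ring
      refine ⟨Q + Polynomial.C L, hexp, ?_⟩
      rw [gplOne, if_pos (by simp), finitePart_eq (hasLogExpansion_of_isBigO hexp)]
    · have hgO : (fun u : ℝ => gpl w (1 - u)) =O[𝓝[>] 0] fun t : ℝ => t ^ (-(1 / 4) : ℝ) := by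
        have := (hP.trans (rpow_isBigO (b := -(1 / 4)) (by norm_num))).add (eval_log_isBigO P)
        simpa using this
      have hkc : ContinuousOn (fun t : ℝ => gpl w t / ((t : ℂ) - α)) (Ioo 0 1) :=
        (hgc.mul hα.continuousOn).congr fun t _ => div_eq_mul_inv _ _
      have hkO : (fun u : ℝ => gpl w (1 - u) / (((1 - u : ℝ) : ℂ) - α)) =O[𝓝[>] 0]
          fun t : ℝ => t ^ (-(1 / 2) : ℝ) := by
        have h2 := rpow_mul_isBigO hgO (isBigO_rpow_of_tendsto (kernel_tendsto_one h1)
          (b := -(1 / 4)) (by norm_num))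
        norm_num at h2
        simpa [div_eq_mul_inv] using h2
      obtain ⟨L, hL⟩ := exists_limit_of_hasDerivAt hkc (fun t ht => gpl_hasDerivAt hw ht) hkO
      refine ⟨Polynomial.C L, by simpa using hL, ?_⟩
      have hlim : Tendsto (fun ε : ℝ => gpl (α :: w) (1 - ε)) (𝓝[>] 0) (𝓝 L) :=
        tendsto_sub_nhds_zero_iff.1 (tendsto_zero_of_isBigO hL)
      rw [gplOne, if_neg (by simpa using h1), gpl_one_eq_limit hw hkO hlim]
      simp

end

section

/-! ### Spaces of generalized polylogarithms -/

/-- The words of length `n` with one letter in `T`, followed by at most `k` letters, and all other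
letters in `A`. -/
def wordSet (A T : Set ℂ) (k n : ℕ) : Set (List ℂ) :=
  {w | ∃ u s v, w = u ++ s :: v ∧ (∀ a ∈ u, a ∈ A) ∧ s ∈ T ∧ (∀ a ∈ v, a ∈ A) ∧
    v.length ≤ k ∧ u.length + v.length + 1 = n}

/-- The functions that agree on `(0, 1)` with a rational combination of generalized
polylogarithms of words in `wordSet A T k n`. -/
def gplFun (A T : Set ℂ) (k n : ℕ) : Submodule ℚ (ℝ → ℂ) :=
  Submodule.span ℚ {F | EqOn F 0 (Ioo 0 1) ∨ ∃ w ∈ wordSet A T k n, F = gpl w}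

variable {A T : Set ℂ} {k n : ℕ}

theorem singleton_mem_wordSet {s : ℂ} (hs : s ∈ T) : [s] ∈ wordSet A T 0 1 :=
  ⟨[], s, [], rfl, by simp, hs, by simp, by simp, by simp⟩

theorem cons_mem_wordSet {α : ℂ} {w : List ℂ} (hα : α ∈ A) (hw : w ∈ wordSet A T k n) :
    α :: w ∈ wordSet A T k (n + 1) := by
  obtain ⟨u, s, v, rfl, hu, hs, hv, hk, hn⟩ := hw
  refine ⟨α :: u, s, v, rfl, ?_, hs, hv, hk, ?_⟩
  · simpa using ⟨hα, hu⟩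
  · simp only [List.length_cons]; omega

theorem wordSet_mono {k' : ℕ} (h : k ≤ k') : wordSet A T k n ⊆ wordSet A T k' n := by
  rintro w ⟨u, s, v, rfl, hu, hs, hv, hk, hn⟩
  exact ⟨u, s, v, rfl, hu, hs, hv, hk.trans h, hn⟩

theorem gpl_mem_gplFun {w : List ℂ} (hw : w ∈ wordSet A T k n) : gpl w ∈ gplFun A T k n :=
  Submodule.subset_span (Or.inr ⟨w, hw, rfl⟩)

theorem gplFun_mono {k' : ℕ} (h : k ≤ k') : gplFun A T k n ≤ gplFun A T k' n :=
  Submodule.span_mono fun _ hF => hF.imp_right fun ⟨w, hw, e⟩ => ⟨w, wordSet_mono h hw, e⟩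

theorem gplFun_congr {F G : ℝ → ℂ} (hF : F ∈ gplFun A T k n) (h : EqOn G F (Ioo 0 1)) :
    G ∈ gplFun A T k n := by
  have h1 : G - F ∈ gplFun A T k n :=
    Submodule.subset_span (Or.inl fun t ht => by simp [h ht])
  simpa using add_mem h1 hF

/-- The letter from `T` is nonzero, so no word here is a pure power of `log`. Its GPL therefore
vanishes at 0, which fixes the constant of integration whenever primitives are compared. -/
theorem wordSet_admissible (hA : ∀ a ∈ A, Admissible a) (hT : ∀ s ∈ T, Admissible s ∧ s ≠ 0)
    {w : List ℂ} (hw : w ∈ wordSet A T k n) :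
    (∀ β ∈ w, Admissible β) ∧ ¬ ∀ β ∈ w, β = 0 := by
  obtain ⟨u, s, v, rfl, hu, hs, hv, -, -⟩ := hw
  refine ⟨fun β hβ => ?_, fun h => (hT s hs).2 (h s (by simp))⟩
  rcases List.mem_append.1 hβ with h | h
  · exact hA _ (hu _ h)
  · rcases List.mem_cons.1 h with rfl | h
    · exact (hT _ hs).1
    · exact hA _ (hv _ h)

theorem rat_smul_hasDerivAt {F : ℝ → ℂ} {F' : ℂ} {t : ℝ} (h : HasDerivAt F F' t) (q : ℚ) :
    HasDerivAt (q • F) (q • F') t := by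
  have h1 := h.const_mul (q : ℂ)
  have e : q • F = fun t => (q : ℂ) * F t := by
    funext t; simp [Rat.smul_def]
  rw [e, Rat.smul_def]
  exact h1

/-- A first-order primitive of an element of `gplFun`. -/
theorem exists_primitive (hA : ∀ a ∈ A, Admissible a) (hT : ∀ s ∈ T, Admissible s ∧ s ≠ 0)
    {F : ℝ → ℂ} (hF : F ∈ gplFun A T k n) {α : ℂ} (hα : α ∈ A) :
    ∃ J ∈ gplFun A T k (n + 1), (∀ t ∈ Ioo (0 : ℝ) 1, HasDerivAt J (F t / ((t : ℂ) - α)) t) ∧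
      Tendsto J (𝓝[>] 0) (𝓝 0) := by
  induction hF using Submodule.span_induction with
  | mem F hF =>
    rcases hF with hF | ⟨w, hw, rfl⟩
    · refine ⟨0, zero_mem _, fun t ht => ?_, tendsto_const_nhds⟩
      rw [hF ht]
      simp [hasDerivAt_zero]
    · have hw' := cons_mem_wordSet hα hw
      have had := wordSet_admissible hA hT hw'
      exact ⟨_, gpl_mem_gplFun hw', fun t ht => gpl_hasDerivAt had.1 ht,
        gpl_tendsto_zero had.1 had.2⟩
  | zero =>
    refine ⟨0, zero_mem _, fun t _ => ?_, tendsto_const_nhds⟩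
    simp [hasDerivAt_zero]
  | add F G _ _ hF hG =>
    obtain ⟨J, hJ, hJd, hJ0⟩ := hF
    obtain ⟨K, hK, hKd, hK0⟩ := hG
    refine ⟨J + K, add_mem hJ hK, fun t ht => ?_, add_zero (0 : ℂ) ▸ hJ0.add hK0⟩
    refine ((hJd t ht).add (hKd t ht)).congr_deriv ?_
    simp [add_div]
  | smul q F _ hF =>
    obtain ⟨J, hJ, hJd, hJ0⟩ := hF
    refine ⟨q • J, Submodule.smul_mem _ _ hJ, fun t ht => ?_, ?_⟩
    · refine (rat_smul_hasDerivAt (hJd t ht) q).congr_deriv ?_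
      simp [Rat.smul_def, mul_div_assoc]
    · have := hJ0.const_mul (q : ℂ)
      rw [mul_zero] at this
      refine this.congr fun t => ?_
      simp [Rat.smul_def]

/-- A function vanishing at `0` whose derivative is a combination of `F i / (t - α i)` with `F i`
in `gplFun`. -/
theorem mem_gplFun_of_hasDerivAt (hA : ∀ a ∈ A, Admissible a)
    (hT : ∀ s ∈ T, Admissible s ∧ s ≠ 0) {ι : Type*} (I : Finset ι) (q : ι → ℚ)
    (F : ι → ℝ → ℂ) (α : ι → ℂ) (hF : ∀ i ∈ I, F i ∈ gplFun A T k n) (hα : ∀ i ∈ I, α i ∈ A)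
    {G : ℝ → ℂ} (hG : ∀ t ∈ Ioo (0 : ℝ) 1,
      HasDerivAt G (∑ i ∈ I, (q i : ℂ) * (F i t / ((t : ℂ) - α i))) t)
    (hG0 : Tendsto G (𝓝[>] 0) (𝓝 0)) : G ∈ gplFun A T k (n + 1) := by
  choose! J hJ hJd hJ0 using fun i (hi : i ∈ I) => exists_primitive hA hT (hF i hi) (hα i hi)
  have hmem : ∑ i ∈ I, q i • J i ∈ gplFun A T k (n + 1) :=
    Submodule.sum_mem _ fun i hi => Submodule.smul_mem _ _ (hJ i hi)
  refine gplFun_congr hmem (eqOn_of_hasDerivAt hG ?_ hG0 ?_)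
  · intro t ht
    refine (HasDerivAt.sum fun i hi => rat_smul_hasDerivAt (hJd i hi t ht) (q i)).congr_deriv ?_
    simp [Rat.smul_def]
  · have : Tendsto (fun t => ∑ i ∈ I, (q i : ℂ) * J i t) (𝓝[>] 0) (𝓝 (∑ i ∈ I, (q i : ℂ) * 0)) :=
      tendsto_finsetSum _ fun i hi => (hJ0 i hi).const_mul _
    rw [show ∑ i ∈ I, (q i : ℂ) * 0 = 0 by simp] at this
    refine this.congr fun t => ?_
    simp [Rat.smul_def]

theorem gplFun_continuousOn (hA : ∀ a ∈ A, Admissible a) (hT : ∀ s ∈ T, Admissible s ∧ s ≠ 0)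
    {F : ℝ → ℂ} (hF : F ∈ gplFun A T k n) : ContinuousOn F (Ioo 0 1) := by
  induction hF using Submodule.span_induction with
  | mem F hF =>
    rcases hF with hF | ⟨w, hw, rfl⟩
    · exact continuousOn_const.congr hF
    · exact gpl_continuousOn (wordSet_admissible hA hT hw).1
  | zero => exact continuousOn_const
  | add F G _ _ hF hG => exact hF.add hG
  | smul q F _ hF =>
    refine (continuousOn_const.mul hF : ContinuousOn (fun t => (q : ℂ) * F t) _).congr
      fun t _ => ?_
    simp [Rat.smul_def]

/-- The limit at `1` of an element of `gplFun` is a combination of regularized values. -/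
theorem limit_mem_span (hA : ∀ a ∈ A, Admissible a) (hT : ∀ s ∈ T, Admissible s ∧ s ≠ 0)
    {F : ℝ → ℂ} (hF : F ∈ gplFun A T k n) {L : ℂ} (hL : Tendsto F (𝓝[<] 1) (𝓝 L)) :
    L ∈ Submodule.span ℚ (gplOne '' wordSet A T k n) := by
  -- The generators need not converge at 1, so the induction carries a logarithmic expansion instead
  -- of a limit.
  have key : ∃ P : Polynomial ℂ, HasLogExpansion (fun ε => F (1 - ε)) P ∧
      P.coeff 0 ∈ Submodule.span ℚ (gplOne '' wordSet A T k n) := by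
    clear hL
    induction hF using Submodule.span_induction with
    | mem F hF =>
      rcases hF with hF | ⟨w, hw, rfl⟩
      · refine ⟨0, ?_, by simp⟩
        refine tendsto_const_nhds.congr' ?_
        filter_upwards [Ioo_mem_nhdsGT (zero_lt_one' ℝ)] with t ht
        simp [hF (one_sub_mem ht)]
      · obtain ⟨P, hP, hP0⟩ := gpl_expansion w (wordSet_admissible hA hT hw).1
        exact ⟨P, hasLogExpansion_of_isBigO hP,
          hP0 ▸ Submodule.subset_span (mem_image_of_mem _ hw)⟩
    | zero => exact ⟨0, by simp [HasLogExpansion], by simp⟩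
    | add F G _ _ hF hG =>
      obtain ⟨P, hP, hP0⟩ := hF
      obtain ⟨Q, hQ, hQ0⟩ := hG
      refine ⟨P + Q, ?_, by simpa using add_mem hP0 hQ0⟩
      have := Tendsto.add hP hQ
      rw [add_zero] at this
      refine this.congr fun ε => ?_
      simp only [Pi.add_apply, Polynomial.eval_add]
      ring
    | smul q F _ hF =>
      obtain ⟨P, hP, hP0⟩ := hF
      refine ⟨Polynomial.C (q : ℂ) * P, ?_, ?_⟩
      · have := Tendsto.const_mul (q : ℂ) hP
        rw [mul_zero] at this
        refine this.congr fun ε => ?_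
        simp only [Pi.smul_apply, Rat.smul_def, Polynomial.eval_mul, Polynomial.eval_C]
        ring
      · rw [Polynomial.coeff_C_mul, ← Rat.smul_def]
        exact Submodule.smul_mem _ _ hP0
  obtain ⟨P, hP, hP0⟩ := key
  -- Convergence of `F` makes the constant polynomial `L` another expansion; by uniqueness it is
  -- `P`.
  have hc : HasLogExpansion (fun ε => F (1 - ε)) (Polynomial.C L) := by
    simpa [HasLogExpansion] using tendsto_sub_nhds_zero_iff.2 (hL.comp tendsto_one_sub)
  rw [hP.unique hc, Polynomial.coeff_C_zero] at hP0
  exact hP0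

/-! ### Shuffle with a GPL of weight one -/

theorem gpl_nil (t : ℝ) : gpl [] t = 1 := by simp [gpl]

/-- The factor `gpl [a]` may be `log t`; the orders `-1/4` and `1/2` still add up to `1/4 > 0`. -/
theorem gpl_singleton_mul_tendsto {a : ℂ} (ha : Admissible a) {w : List ℂ}
    (hw : ∀ β ∈ w, Admissible β) (h0 : ¬ ∀ β ∈ w, β = 0) :
    Tendsto (gpl [a] * gpl w) (𝓝[>] 0) (𝓝 0) := by
  have h1 := rpow_mul_isBigO (gpl_isBigO (w := [a]) (by simpa using ha)) (gpl_isBigO_half hw h0)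
  norm_num at h1
  refine h1.trans_tendsto ?_
  have h2 := (Real.continuousAt_rpow_const 0 (1 / 4 : ℝ) (Or.inr (by norm_num))).tendsto
  rw [Real.zero_rpow (by norm_num)] at h2
  exact h2.mono_left nhdsWithin_le_nhds

/-- Multiplication by a generalized polylogarithm of weight one. -/
theorem gpl_singleton_mul_mem (hA : ∀ a ∈ A, Admissible a)
    (hT : ∀ s ∈ T, Admissible s ∧ s ≠ 0) {a : ℂ} (ha : a ∈ A) {F : ℝ → ℂ}
    (hF : F ∈ gplFun A T 0 n) : gpl [a] * F ∈ gplFun A T 1 (n + 1) := by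
  have hga : ∀ β ∈ [a], Admissible β := by simpa using hA a ha
  induction hF using Submodule.span_induction with
  | mem F hF =>
    rcases hF with hF | ⟨w, hw, rfl⟩
    · exact Submodule.subset_span (Or.inl fun t ht => by simp [hF ht])
    · induction w generalizing n with
      | nil =>
        obtain ⟨u, s, v, h, -⟩ := hw
        simp at h
      | cons α w ih =>
        have had := wordSet_admissible hA hT hw
        have hzero := gpl_singleton_mul_tendsto (hA a ha) had.1 had.2
        obtain ⟨u, s, v, h, hu, hs, hv, hk, hn⟩ := id hw
        obtain rfl : v = [] := by simpa using hk
        cases u with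
        | nil =>
          simp only [List.nil_append, List.cons.injEq] at h
          obtain ⟨rfl, rfl⟩ := h
          simp only [List.length_nil, zero_add] at hn
          subst hn
          -- Base of the shuffle: `[a] ⧢ [α] = [a, α] + [α, a]`. The second word puts `a` behind the
          -- letter of `T`, hence the bound 1 in the conclusion.
          have w1 : [a, α] ∈ wordSet A T 1 2 :=
            ⟨[a], α, [], rfl, by simpa using ha, hs, by simp, by simp, by simp⟩
          have w2 : [α, a] ∈ wordSet A T 1 2 :=
            ⟨[], α, [a], rfl, by simp, hs, by simpa using ha, by simp, by simp⟩
          have a1 := wordSet_admissible hA hT w1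
          have a2 := wordSet_admissible hA hT w2
          refine gplFun_congr (add_mem (gpl_mem_gplFun w1) (gpl_mem_gplFun w2))
            (eqOn_of_hasDerivAt (fun t ht => (gpl_hasDerivAt hga ht).mul
              (gpl_hasDerivAt had.1 ht)) (fun t ht => ?_) hzero ?_)
          · refine ((gpl_hasDerivAt a1.1 ht).add (gpl_hasDerivAt a2.1 ht)).congr_deriv ?_
            simp only [gpl_nil]
            ring
          · exact add_zero (0 : ℂ) ▸ (gpl_tendsto_zero a1.1 a1.2).add (gpl_tendsto_zero a2.1 a2.2)
        | cons β u =>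
          simp only [List.cons_append, List.cons.injEq] at h
          obtain ⟨rfl, rfl⟩ := h
          obtain ⟨m, rfl⟩ : ∃ m, n = m + 1 := ⟨u.length + 1, by simpa using hn.symm⟩
          have hα : α ∈ A := hu α (by simp)
          have hw' : u ++ [s] ∈ wordSet A T 0 m :=
            ⟨u, s, [], rfl, fun x hx => hu x (by simp [hx]), hs, by simp, by simp, by
              simpa using hn⟩
          have ih' := ih (n := m) hw'
          -- The product rule is the shuffle recursion: the derivative of `G(a) G(α, w)` is `G(α,
          -- w)/(t - a) + G(a) G(w)/(t - α)`.
          refine mem_gplFun_of_hasDerivAt hA hT (k := 1) (Finset.univ : Finset (Fin 2)) (fun _ => 1)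
            ![gpl (α :: (u ++ [s])), gpl [a] * gpl (u ++ [s])] ![a, α] ?_ ?_ ?_ hzero
          · intro i _
            fin_cases i
            · exact gplFun_mono zero_le_one (gpl_mem_gplFun hw)
            · exact ih'
          · intro i _
            fin_cases i
            · exact ha
            · exact hα
          · intro t ht
            refine ((gpl_hasDerivAt hga ht).mul (gpl_hasDerivAt had.1 ht)).congr_deriv ?_
            simp only [Fin.sum_univ_two, Matrix.cons_val_zero, Matrix.cons_val_one, gpl_nil,
              Pi.mul_apply, Rat.cast_one]
            ring
  | zero => simp
  | add F G _ _ hF hG => rw [mul_add]; exact add_mem hF hG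
  | smul q F _ hF => rw [mul_smul_comm]; exact Submodule.smul_mem _ _ hF

/-! ### Comparison with `gplSpace` -/

/-- At most `k` letters follow the one in `T`, so its position is at least `n - k ≥ m`. -/
theorem gplOne_mem_gplSpace {S : Set ℂ} {m : ℕ} {w : List ℂ} (hm : m + k ≤ n)
    (hw : w ∈ wordSet ({0, 1} ∪ S) T k n) : gplOne w ∈ gplSpace n m S T := by
  obtain ⟨u, s, v, rfl, hu, hs, hv, hk, hn⟩ := hw
  subst hn
  have hlen : (u ++ s :: v).length = u.length + v.length + 1 := by simp; omega
  have hj : u.length < u.length + v.length + 1 := by omega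
  refine Submodule.mem_iSup_of_mem ⟨u.length, hj⟩
    (Submodule.mem_iSup_of_mem (show m ≤ u.length + 1 by omega) (Submodule.subset_span ?_))
  refine ⟨fun i => (u ++ s :: v)[(i : ℕ)]'(by rw [hlen]; exact i.2), ?_, ?_, ?_⟩
  · intro l hl
    have hl' : (l : ℕ) ≠ u.length := fun h => hl (Fin.ext h)
    rcases lt_or_gt_of_ne hl' with h | h
    · simp only [List.getElem_append_left h]
      exact hu _ (List.getElem_mem _)
    · obtain ⟨d, hd⟩ : ∃ d, (l : ℕ) = u.length + (d + 1) := ⟨l - u.length - 1, by omega⟩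
      have hdv : d < v.length := by have := l.2; omega
      have : (u ++ s :: v)[(l : ℕ)]'(by rw [hlen]; exact l.2) = v[d] := by
        simp only [hd]
        rw [List.getElem_append_right (by omega)]
        simp
      simp only [this]
      exact hv _ (List.getElem_mem _)
  · simpa using hs
  · congr 1
    refine List.ext_getElem (by rw [List.length_ofFn, hlen]) fun i h1 h2 => ?_
    rw [List.getElem_ofFn]

theorem span_le_gplSpace {S : Set ℂ} {m : ℕ} (hm : m + k ≤ n) :
    Submodule.span ℚ (gplOne '' wordSet ({0, 1} ∪ S) T k n) ≤ gplSpace n m S T := by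
  rw [Submodule.span_le]
  rintro _ ⟨w, hw, rfl⟩
  exact gplOne_mem_gplSpace hm hw

end

section

/-! ### Power series with polynomially bounded coefficients -/

/-- The coefficients grow at most polynomially. -/
def PolyBounded (c : ℕ → ℂ) : Prop := ∃ (B : ℝ) (p : ℕ), ∀ k, ‖c k‖ ≤ B * ((k : ℝ) + 1) ^ p

/-- The power series with coefficients `c`. -/
def genFun (c : ℕ → ℂ) (z : ℂ) : ℂ := ∑' k, c k * z ^ k

theorem PolyBounded.mono {c d : ℕ → ℂ} (hc : PolyBounded c) (h : ∀ k, ‖d k‖ ≤ ‖c k‖) :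
    PolyBounded d := by
  obtain ⟨B, p, hB⟩ := hc
  exact ⟨B, p, fun k => (h k).trans (hB k)⟩

theorem PolyBounded.nat_mul {c : ℕ → ℂ} (hc : PolyBounded c) :
    PolyBounded fun k => (k : ℂ) * c k := by
  obtain ⟨B, p, hB⟩ := hc
  refine ⟨B, p + 1, fun k => ?_⟩
  have h0 := (norm_nonneg _).trans (hB k)
  rw [norm_mul, Complex.norm_natCast, pow_succ, ← mul_assoc, mul_comm]
  exact mul_le_mul (hB k) (by linarith) (by positivity) h0

theorem PolyBounded.psum {c : ℕ → ℂ} (hc : PolyBounded c) :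
    PolyBounded fun k => ∑ j ∈ Finset.range k, c j := by
  obtain ⟨B, p, hB⟩ := hc
  have hB0 : 0 ≤ B := by simpa using (norm_nonneg _).trans (hB 0)
  refine ⟨B, p + 1, fun k => (norm_sum_le _ _).trans ?_⟩
  calc ∑ j ∈ Finset.range k, ‖c j‖ ≤ ∑ j ∈ Finset.range k, B * ((k : ℝ) + 1) ^ p := by
        refine Finset.sum_le_sum fun j hj => (hB j).trans ?_
        have : (j : ℝ) ≤ k := by exact_mod_cast (Finset.mem_range.1 hj).le
        gcongr
    _ = B * ((k : ℝ) + 1) ^ p * k := by simp; ring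
    _ ≤ B * ((k : ℝ) + 1) ^ p * (k + 1) := by gcongr; linarith
    _ = _ := by ring

theorem PolyBounded.add {c d : ℕ → ℂ} (hc : PolyBounded c) (hd : PolyBounded d) :
    PolyBounded fun k => c k + d k := by
  obtain ⟨B, p, hB⟩ := hc
  obtain ⟨C, q, hC⟩ := hd
  have hB0 : 0 ≤ B := by simpa using (norm_nonneg _).trans (hB 0)
  have hC0 : 0 ≤ C := by simpa using (norm_nonneg _).trans (hC 0)
  refine ⟨B + C, p + q, fun k => (norm_add_le _ _).trans ?_⟩
  have h1 : (1 : ℝ) ≤ k + 1 := by simp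
  have h2 : ((k : ℝ) + 1) ^ p ≤ (k + 1) ^ (p + q) := pow_le_pow_right₀ h1 (by omega)
  have h3 : ((k : ℝ) + 1) ^ q ≤ (k + 1) ^ (p + q) := pow_le_pow_right₀ h1 (by omega)
  rw [add_mul]
  exact add_le_add ((hB k).trans (by gcongr)) ((hC k).trans (by gcongr))

theorem PolyBounded.const_mul {c : ℕ → ℂ} (hc : PolyBounded c) (a : ℂ) :
    PolyBounded fun k => a * c k := by
  obtain ⟨B, p, hB⟩ := hc
  refine ⟨‖a‖ * B, p, fun k => ?_⟩
  rw [norm_mul, mul_assoc]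
  exact mul_le_mul_of_nonneg_left (hB k) (norm_nonneg _)

theorem PolyBounded.summable {c : ℕ → ℂ} (hc : PolyBounded c) {ρ : ℝ} (h0 : 0 ≤ ρ)
    (h1 : ρ < 1) : Summable fun k => ‖c k‖ * ρ ^ k := by
  obtain ⟨B, p, hB⟩ := hc
  have hB0 : 0 ≤ B := by simpa using (norm_nonneg _).trans (hB 0)
  have hρ : ‖ρ‖ < 1 := by rwa [Real.norm_eq_abs, abs_of_nonneg h0]
  have s1 := (summable_pow_mul_geometric_of_norm_lt_one p hρ).add
    (summable_geometric_of_norm_lt_one hρ)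
  refine Summable.of_nonneg_of_le (fun k => by positivity) (fun k => ?_)
    (s1.mul_left (B * 2 ^ (p - 1)))
  have h2 := add_pow_le (Nat.cast_nonneg (α := ℝ) k) zero_le_one p
  rw [one_pow] at h2
  calc ‖c k‖ * ρ ^ k ≤ B * (2 ^ (p - 1) * ((k : ℝ) ^ p + 1)) * ρ ^ k := by
        gcongr
        exact (hB k).trans (by gcongr)
    _ = _ := by ring

theorem PolyBounded.summable_mul_pow {c : ℕ → ℂ} (hc : PolyBounded c) {z : ℂ} (hz : ‖z‖ < 1) :
    Summable fun k => c k * z ^ k := by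
  refine Summable.of_norm ((hc.summable (norm_nonneg z) hz).congr fun k => ?_)
  rw [norm_mul, norm_pow]

theorem genFun_add {c d : ℕ → ℂ} (hc : PolyBounded c) (hd : PolyBounded d) {z : ℂ}
    (hz : ‖z‖ < 1) : genFun (fun k => c k + d k) z = genFun c z + genFun d z := by
  simp only [genFun, add_mul]
  exact (hc.summable_mul_pow hz).tsum_add (hd.summable_mul_pow hz)

theorem genFun_const_mul (c : ℕ → ℂ) (a z : ℂ) :
    genFun (fun k => a * c k) z = a * genFun c z := by
  simp only [genFun, mul_assoc]
  exact tsum_mul_left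

theorem genFun_zero {c : ℕ → ℂ} (h0 : c 0 = 0) : genFun c 0 = 0 := by
  rw [genFun, tsum_eq_single 0 (fun k hk => by simp [hk])]
  simp [h0]

theorem genFun_hasDerivAt' {c : ℕ → ℂ} (hc : PolyBounded c) {z : ℂ} (hz : ‖z‖ < 1) :
    HasDerivAt (genFun c) (∑' k, c k * ((k : ℂ) * z ^ (k - 1))) z := by
  obtain ⟨ρ, hρ, hρ1⟩ := exists_between hz
  have hρ0 : 0 < ρ := (norm_nonneg z).trans_lt hρ
  have hs := (hc.nat_mul.summable hρ0.le hρ1).mul_right ρ⁻¹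
  refine hasDerivAt_tsum_of_isPreconnected (g := fun k z => c k * z ^ k)
    (g' := fun k z => c k * ((k : ℂ) * z ^ (k - 1))) hs (Metric.isOpen_ball (x := (0 : ℂ)) (ε := ρ))
    (convex_ball (0 : ℂ) ρ).isPreconnected ?_ ?_ (Metric.mem_ball_self hρ0)
    (hc.summable_mul_pow (by simp)) (by simpa using hρ)
  · intro k y _
    exact (hasDerivAt_pow k y).const_mul (c k)
  · intro k y hy
    rcases k with _ | k
    · simp
    · have hy' : ‖y‖ ≤ ρ := by simpa using (mem_ball_zero_iff.1 hy).le
      simp only [norm_mul, norm_pow, Nat.add_sub_cancel]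
      calc ‖c (k + 1)‖ * (‖((k + 1 : ℕ) : ℂ)‖ * ‖y‖ ^ k)
          ≤ ‖c (k + 1)‖ * (‖((k + 1 : ℕ) : ℂ)‖ * ρ ^ k) := by gcongr
        _ = _ := by field_simp; ring

/-- The operator `z d/dz` multiplies the coefficients by `k`. Keeping the quotient by `z` lets `d
log z` appear after substitution. -/
theorem genFun_hasDerivAt {c : ℕ → ℂ} (hc : PolyBounded c) {z : ℂ} (hz : ‖z‖ < 1)
    (hz0 : z ≠ 0) : HasDerivAt (genFun c) (genFun (fun k => (k : ℂ) * c k) z / z) z := by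
  refine (genFun_hasDerivAt' hc hz).congr_deriv ?_
  rw [genFun, ← tsum_div_const]
  refine tsum_congr fun k => ?_
  rcases k with _ | k
  · simp
  · rw [Nat.add_sub_cancel, pow_succ]; field_simp

theorem genFun_psum {c : ℕ → ℂ} (hc : PolyBounded c) {z : ℂ} (hz : ‖z‖ < 1) :
    genFun (fun k => ∑ j ∈ Finset.range k, c j) z = z * genFun c z / (1 - z) := by
  have h1 : 1 - z ≠ 0 := by
    intro h
    rw [← sub_eq_zero.1 h] at hz
    simp at hz
  have hs := hc.psum.summable_mul_pow hz
  rw [eq_div_iff h1]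
  -- Generating-function form of `S_(k+1) = S_k + c_k` with `S_0 = 0`.
  have h2 : genFun (fun k => ∑ j ∈ Finset.range k, c j) z =
      z * (genFun (fun k => ∑ j ∈ Finset.range k, c j) z + genFun c z) := by
    rw [← genFun_add hc.psum hc hz]
    conv_lhs => rw [genFun, hs.tsum_eq_zero_add]
    rw [genFun, ← tsum_mul_left]
    simp only [Finset.range_zero, Finset.sum_empty, zero_mul, zero_add, Finset.sum_range_succ]
    refine tsum_congr fun k => ?_
    ring
  linear_combination h2

/-! ### The substitution `z = (t (1 - t²) / (x (1 - x²)))²` -/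

/-- The argument of the power series as a function on `(0, 1)`. -/
def ratio (x : ℂ) (t : ℝ) : ℂ := ((t : ℂ) * (1 - (t : ℂ) ^ 2) / (x * (1 - x ^ 2))) ^ 2

/-- The roots of `1 - ratio x t`, with multiplicity. -/
def letterVec (x : ℂ) : Fin 6 → ℂ :=
  ![x, -x, sigma 0 0 x, sigma 0 1 x, sigma 1 0 x, sigma 1 1 x]

theorem letterVec_mem (x : ℂ) (i : Fin 6) : letterVec x i ∈ letters x := by
  fin_cases i <;> simp [letterVec, letters]

/-- Only the square of the root enters below, so the choice of branch is immaterial. -/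
theorem sq_I_mul_cpow (y : ℂ) : (Complex.I * y ^ (1 / 2 : ℂ)) ^ 2 = -y := by
  have : (y ^ (1 / 2 : ℂ)) ^ 2 = y := by
    rw [one_div]; exact_mod_cast Complex.cpow_nat_inv_pow y two_ne_zero
  rw [mul_pow, this, Complex.I_sq, neg_one_mul]

/-- With `p(t) = t(1 - t²)`, the equation `p(s) = p(x)` has roots `x, σ_{1,0}, σ_{1,1}`, and `p(s) =
-p(x)` has roots `-x, σ_{0,0}, σ_{0,1}`. -/
theorem letters_sq (x s : ℂ) (hs : s ∈ letters x) :
    (s * (1 - s ^ 2)) ^ 2 = (x * (1 - x ^ 2)) ^ 2 := by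
  have hy := sq_I_mul_cpow (3 * x ^ 2 - 4)
  simp only [letters, sigma, mem_insert_iff, mem_singleton_iff, pow_zero, pow_one, one_mul,
    mul_one, neg_mul, mul_neg] at hs
  generalize Complex.I * (3 * x ^ 2 - 4) ^ (1 / 2 : ℂ) = y at hy hs
  rcases hs with rfl | rfl | rfl | rfl | rfl | rfl
  · rfl
  · ring
  · rw [show (x + y) / 2 * (1 - ((x + y) / 2) ^ 2) = -(x * (1 - x ^ 2)) by
      linear_combination (-(3 * x + y) / 8) * hy]
    ring
  · rw [show (x + -y) / 2 * (1 - ((x + -y) / 2) ^ 2) = -(x * (1 - x ^ 2)) by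
      linear_combination (-(3 * x - y) / 8) * hy]
    ring
  · rw [show (-x + y) / 2 * (1 - ((-x + y) / 2) ^ 2) = (x * (1 - x ^ 2)) by
      linear_combination ((3 * x - y) / 8) * hy]
  · rw [show (-x + -y) / 2 * (1 - ((-x + -y) / 2) ^ 2) = (x * (1 - x ^ 2)) by
      linear_combination ((3 * x + y) / 8) * hy]

theorem cubic_le {t : ℝ} (ht : 0 ≤ t) : t * (1 - t ^ 2) ≤ 2 / (3 * Real.sqrt 3) := by
  have h3 : (0 : ℝ) < Real.sqrt 3 := by positivity
  have hs : Real.sqrt 3 ^ 2 = 3 := Real.sq_sqrt (by norm_num)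
  rw [le_div_iff₀ (by positivity)]
  have h := mul_nonneg (sq_nonneg (Real.sqrt 3 * t - 1)) (by positivity :
    (0 : ℝ) ≤ Real.sqrt 3 * t + 2)
  -- The maximum is attained at `t = 1/√3`, hence the double root in the factorisation.
  have e : (Real.sqrt 3 * t - 1) ^ 2 * (Real.sqrt 3 * t + 2) =
      2 - t * (1 - t ^ 2) * (3 * Real.sqrt 3) := by
    linear_combination (Real.sqrt 3 * t ^ 3) * hs
  linarith

theorem cubic_norm_le {t : ℝ} (ht : t ∈ Icc (0 : ℝ) 1) :
    ‖(t : ℂ) * (1 - (t : ℂ) ^ 2)‖ ≤ 2 / (3 * Real.sqrt 3) := by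
  have e : (t : ℂ) * (1 - (t : ℂ) ^ 2) = ((t * (1 - t ^ 2) : ℝ) : ℂ) := by push_cast; rfl
  have h0 : 0 ≤ t * (1 - t ^ 2) := mul_nonneg ht.1 (by nlinarith [ht.1, ht.2])
  rw [e, Complex.norm_real, Real.norm_eq_abs, abs_of_nonneg h0]
  exact cubic_le ht.1

variable {x : ℂ}

/-- A letter in `[0,1]` would satisfy `|p(s)| = |p(x)|`, exceeding the maximum of `p` there. -/
theorem letters_notMem (hx : 2 / (3 * Real.sqrt 3) < ‖x * (1 - x ^ 2)‖) {s : ℂ}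
    (hs : s ∈ letters x) {t : ℝ} (ht : t ∈ Icc (0 : ℝ) 1) : (t : ℂ) ≠ s := by
  rintro rfl
  have h := congrArg norm (letters_sq x _ hs)
  rw [norm_pow, norm_pow] at h
  have h2 := (pow_left_inj₀ (norm_nonneg _) (norm_nonneg _) two_ne_zero).1 h
  linarith [cubic_norm_le ht]

theorem letters_admissible (hx : 2 / (3 * Real.sqrt 3) < ‖x * (1 - x ^ 2)‖) :
    ∀ s ∈ letters x, Admissible s ∧ s ≠ 0 := fun s hs =>
  ⟨fun _ ht => letters_notMem hx hs (Ioo_subset_Icc_self ht), fun h =>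
    letters_notMem hx hs (t := 0) (by simp) (by simp [h])⟩

theorem denom_ne_zero (hx : 2 / (3 * Real.sqrt 3) < ‖x * (1 - x ^ 2)‖) :
    x * (1 - x ^ 2) ≠ 0 := by
  rw [← norm_pos_iff]
  exact lt_trans (by positivity) hx

theorem exists_ratio_bound (hx : 2 / (3 * Real.sqrt 3) < ‖x * (1 - x ^ 2)‖) :
    ∃ q : ℝ, 0 ≤ q ∧ q < 1 ∧ ∀ t ∈ Icc (0 : ℝ) 1, ‖ratio x t‖ ≤ q := by
  have h0 : 0 < ‖x * (1 - x ^ 2)‖ := norm_pos_iff.2 (denom_ne_zero hx)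
  refine ⟨(2 / (3 * Real.sqrt 3) / ‖x * (1 - x ^ 2)‖) ^ 2, by positivity, ?_, fun t ht => ?_⟩
  · refine pow_lt_one₀ (by positivity) ?_ two_ne_zero
    rwa [div_lt_one h0]
  · rw [ratio, norm_pow, norm_div]
    have := cubic_norm_le ht
    gcongr

theorem ratio_norm_lt (hx : 2 / (3 * Real.sqrt 3) < ‖x * (1 - x ^ 2)‖) {t : ℝ}
    (ht : t ∈ Icc (0 : ℝ) 1) : ‖ratio x t‖ < 1 := by
  obtain ⟨q, -, hq, h⟩ := exists_ratio_bound hx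
  exact (h t ht).trans_lt hq

theorem ofReal_ne {t : ℝ} (ht : t ∈ Ioo (0 : ℝ) 1) :
    (t : ℂ) ≠ 0 ∧ (t : ℂ) - 1 ≠ 0 ∧ (t : ℂ) + 1 ≠ 0 := by
  refine ⟨by exact_mod_cast ht.1.ne', ?_, ?_⟩
  · rw [sub_ne_zero]; exact_mod_cast ht.2.ne
  · exact_mod_cast (by linarith [ht.1] : (0 : ℝ) < t + 1).ne'

theorem ratio_ne_zero (hx : 2 / (3 * Real.sqrt 3) < ‖x * (1 - x ^ 2)‖) {t : ℝ}
    (ht : t ∈ Ioo (0 : ℝ) 1) : ratio x t ≠ 0 := by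
  obtain ⟨h0, h1, h2⟩ := ofReal_ne ht
  refine pow_ne_zero _ (div_ne_zero (mul_ne_zero h0 ?_) (denom_ne_zero hx))
  rw [show (1 : ℂ) - (t : ℂ) ^ 2 = -((t - 1) * (t + 1)) by ring]
  exact neg_ne_zero.2 (mul_ne_zero h1 h2)

theorem ratio_hasDerivAt (x : ℂ) (t : ℝ) : HasDerivAt (ratio x)
    (2 * ((t : ℂ) * (1 - (t : ℂ) ^ 2)) * (1 - 3 * (t : ℂ) ^ 2) / (x * (1 - x ^ 2)) ^ 2) t := by
  have h : HasDerivAt (fun z : ℂ => (z * (1 - z ^ 2) / (x * (1 - x ^ 2))) ^ 2)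
      (2 * ((t : ℂ) * (1 - (t : ℂ) ^ 2)) * (1 - 3 * (t : ℂ) ^ 2) / (x * (1 - x ^ 2)) ^ 2)
      (t : ℂ) := by
    have h1 := (((hasDerivAt_id (t : ℂ)).mul ((hasDerivAt_pow 2 (t : ℂ)).const_sub 1)).div_const
      (x * (1 - x ^ 2))).fun_pow 2
    refine h1.congr_deriv ?_
    simp only [Pi.mul_apply, id, Nat.cast_ofNat, show 2 - 1 = 1 from rfl, pow_one]
    generalize x * (1 - x ^ 2) = X
    ring
  exact h.comp_ofReal

theorem ratio_logDeriv (hx : 2 / (3 * Real.sqrt 3) < ‖x * (1 - x ^ 2)‖) {t : ℝ}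
    (ht : t ∈ Ioo (0 : ℝ) 1) :
    2 * ((t : ℂ) * (1 - (t : ℂ) ^ 2)) * (1 - 3 * (t : ℂ) ^ 2) / (x * (1 - x ^ 2)) ^ 2 =
      ratio x t * (2 * (1 / (t : ℂ) + 1 / ((t : ℂ) - 1) + 1 / ((t : ℂ) + 1))) := by
  obtain ⟨h0, h1, h2⟩ := ofReal_ne ht
  have hX := denom_ne_zero hx
  have e : 2 * (1 / (t : ℂ) + 1 / ((t : ℂ) - 1) + 1 / ((t : ℂ) + 1)) =
      2 * (3 * (t : ℂ) ^ 2 - 1) / (t * (t - 1) * (t + 1)) := by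
    field_simp
    ring
  rw [e, ratio, div_pow]
  generalize x * (1 - x ^ 2) = X at hX
  field_simp
  ring

/-- Logarithmic derivative of the monic cubic with roots `a, b, c`, which Vieta's relations identify
with `t³ - t - abc`. -/
theorem sum_inv_three {t a b c : ℂ} (ha : t - a ≠ 0) (hb : t - b ≠ 0) (hc : t - c ≠ 0)
    (h1 : a + b + c = 0) (h2 : a * b + b * c + c * a = -1) :
    1 / (t - a) + 1 / (t - b) + 1 / (t - c) = (3 * t ^ 2 - 1) / (t ^ 3 - t - a * b * c) := by
  have e : t ^ 3 - t - a * b * c = (t - a) * (t - b) * (t - c) := by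
    linear_combination t ^ 2 * h1 - t * h2
  rw [e]
  field_simp
  linear_combination (-2 * t) * h1 + h2

/-- The left side is `z'/(1 - z) = -(log(1 - z))'`, and `1 - z = (p(x) - p(t))(p(x) + p(t))/p(x)²`
vanishes exactly at the six letters. -/
theorem ratio_logDeriv_one_sub (hx : 2 / (3 * Real.sqrt 3) < ‖x * (1 - x ^ 2)‖) {t : ℝ}
    (ht : t ∈ Ioo (0 : ℝ) 1) :
    2 * ((t : ℂ) * (1 - (t : ℂ) ^ 2)) * (1 - 3 * (t : ℂ) ^ 2) / (x * (1 - x ^ 2)) ^ 2 /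
      (1 - ratio x t) = -∑ i, 1 / ((t : ℂ) - letterVec x i) := by
  have hne : ∀ i, (t : ℂ) - letterVec x i ≠ 0 := fun i =>
    (letters_admissible hx _ (letterVec_mem x i)).1.sub_ne ht
  have hr : 1 - ratio x t ≠ 0 := by
    intro h
    have := ratio_norm_lt hx (Ioo_subset_Icc_self ht)
    rw [← sub_eq_zero.1 h] at this
    simp at this
  have hX := denom_ne_zero hx
  have hy := sq_I_mul_cpow (3 * x ^ 2 - 4)
  have n0 := hne 0
  have n1 := hne 1
  have n2 := hne 2
  have n3 := hne 3
  have n4 := hne 4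
  have n5 := hne 5
  simp only [Fin.sum_univ_six]
  simp only [letterVec, sigma, Matrix.cons_val, pow_zero, pow_one, one_mul, mul_one, neg_mul,
    mul_neg] at n0 n1 n2 n3 n4 n5 ⊢
  rw [ratio] at hr ⊢
  generalize Complex.I * (3 * x ^ 2 - 4) ^ (1 / 2 : ℂ) = y at *
  generalize (t : ℂ) = t at *
  -- The letters are grouped by the two cubics `p(t) = p(x)` and `p(t) = -p(x)`.
  have s1 := sum_inv_three n0 n4 n5 (by ring) (by linear_combination (-1 / 4) * hy)
  have s2 := sum_inv_three n1 n2 n3 (by ring) (by linear_combination (-1 / 4) * hy)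
  have p1 : t ^ 3 - t - x * ((-x + y) / 2) * ((-x + -y) / 2) = x * (1 - x ^ 2) - t * (1 - t ^ 2) := by
    linear_combination (x / 4) * hy
  have p2 : t ^ 3 - t - -x * ((x + y) / 2) * ((x + -y) / 2) =
      -(x * (1 - x ^ 2) + t * (1 - t ^ 2)) := by
    linear_combination (-x / 4) * hy
  rw [p1] at s1
  rw [p2] at s2
  have e : -(1 / (t - x) + 1 / (t - -x) + 1 / (t - (x + y) / 2) + 1 / (t - (x + -y) / 2) +
      1 / (t - (-x + y) / 2) + 1 / (t - (-x + -y) / 2)) =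
      -((3 * t ^ 2 - 1) / (x * (1 - x ^ 2) - t * (1 - t ^ 2)) +
      (3 * t ^ 2 - 1) / (-(x * (1 - x ^ 2) + t * (1 - t ^ 2)))) := by
    rw [← s1, ← s2]; ring
  rw [e]
  generalize x * (1 - x ^ 2) = X at *
  generalize t * (1 - t ^ 2) = p at *
  have hq : X ^ 2 - p ^ 2 ≠ 0 := by
    intro h
    apply hr
    field_simp
    simpa using h
  have hq1 : X - p ≠ 0 := fun h => hq (by linear_combination (X + p) * h)
  have hq2 : X + p ≠ 0 := fun h => hq (by linear_combination (X - p) * h)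
  have hq3 : 1 - (p / X) ^ 2 = (X - p) * (X + p) / X ^ 2 := by field_simp; ring
  rw [hq3, div_neg]
  field_simp
  ring

end

section

/-! ### Power series expressible through generalized polylogarithms -/

/-- The composite of the power series with `ratio x` is a combination of generalized
polylogarithms of weight `n`, with letters in `A` and last letter in `letters x`. -/
structure IsGplSeries (A : Set ℂ) (x : ℂ) (n : ℕ) (c : ℕ → ℂ) : Prop where
  polyBounded : PolyBounded c
  zero : c 0 = 0
  mem : (fun t => genFun c (ratio x t)) ∈ gplFun A (letters x) 0 n

variable {A : Set ℂ} {x : ℂ} {n : ℕ} {c d : ℕ → ℂ}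

theorem ratio_tendsto_zero (x : ℂ) : Tendsto (ratio x) (𝓝[>] 0) (𝓝 0) := by
  have h := (ratio_hasDerivAt x 0).continuousAt.tendsto
  rw [show ratio x 0 = 0 by simp [ratio]] at h
  exact h.mono_left nhdsWithin_le_nhds

theorem genFun_ratio_tendsto_zero (hc : PolyBounded c) (h0 : c 0 = 0) :
    Tendsto (fun t => genFun c (ratio x t)) (𝓝[>] 0) (𝓝 0) := by
  have h := (genFun_hasDerivAt' hc (z := 0) (by simp)).continuousAt.tendsto
  rw [genFun_zero h0] at h
  exact h.comp (ratio_tendsto_zero x)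

theorem genFun_ratio_hasDerivAt (hx : 2 / (3 * Real.sqrt 3) < ‖x * (1 - x ^ 2)‖)
    (hc : PolyBounded c) {t : ℝ} (ht : t ∈ Ioo (0 : ℝ) 1) :
    HasDerivAt (fun t => genFun c (ratio x t))
      (genFun (fun k => (k : ℂ) * c k) (ratio x t) / ratio x t *
        (2 * ((t : ℂ) * (1 - (t : ℂ) ^ 2)) * (1 - 3 * (t : ℂ) ^ 2) / (x * (1 - x ^ 2)) ^ 2)) t :=
  (genFun_hasDerivAt hc (ratio_norm_lt hx (Ioo_subset_Icc_self ht))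
    (ratio_ne_zero hx ht)).comp t (ratio_hasDerivAt x t)

theorem PolyBounded.div_nat (hc : PolyBounded c) : PolyBounded fun k => c k / (k : ℂ) := by
  refine hc.mono fun k => ?_
  rcases k with _ | k
  · simp
  · rw [norm_div, Complex.norm_natCast]
    refine div_le_self (norm_nonneg _) ?_
    simp

theorem IsGplSeries.add (hx : 2 / (3 * Real.sqrt 3) < ‖x * (1 - x ^ 2)‖)
    (hc : IsGplSeries A x n c) (hd : IsGplSeries A x n d) :
    IsGplSeries A x n fun k => c k + d k := by
  refine ⟨hc.1.add hd.1, by simp [hc.2, hd.2], gplFun_congr (add_mem hc.3 hd.3) fun t ht => ?_⟩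
  exact genFun_add hc.1 hd.1 (ratio_norm_lt hx (Ioo_subset_Icc_self ht))

theorem IsGplSeries.rat_mul (hc : IsGplSeries A x n c) (q : ℚ) :
    IsGplSeries A x n fun k => (q : ℂ) * c k := by
  refine ⟨hc.1.const_mul q, by simp [hc.2],
    gplFun_congr (Submodule.smul_mem _ q hc.3) fun t _ => ?_⟩
  simp [genFun_const_mul, Rat.smul_def]

theorem IsGplSeries.sum (hx : 2 / (3 * Real.sqrt 3) < ‖x * (1 - x ^ 2)‖) {ι : Type*}
    (I : Finset ι) (c : ι → ℕ → ℂ) (hc : ∀ i ∈ I, IsGplSeries A x n (c i)) :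
    IsGplSeries A x n fun k => ∑ i ∈ I, c i k := by
  classical
  induction I using Finset.induction_on with
  | empty =>
    refine ⟨⟨0, 0, by simp⟩, by simp, gplFun_congr (zero_mem _) fun t _ => ?_⟩
    simp [genFun]
  | insert i I hi ih =>
    simp only [Finset.sum_insert hi]
    exact (hc i (by simp)).add hx (ih fun j hj => hc j (by simp [hj]))

/-- Dividing by `k` inverts `z d/dz`, so it integrates against `d log z` and prepends one of the
letters `0, 1, -1`. The term `k = 0` is harmless because `c 0 = 0` and `0/0 = 0`. -/
theorem IsGplSeries.div_nat (hx : 2 / (3 * Real.sqrt 3) < ‖x * (1 - x ^ 2)‖)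
    (hA : ∀ a ∈ A, Admissible a) (hA' : {0, 1, -1} ⊆ A) (hc : IsGplSeries A x n c) :
    IsGplSeries A x (n + 1) fun k => c k / (k : ℂ) := by
  refine ⟨hc.1.div_nat, by simp, ?_⟩
  refine mem_gplFun_of_hasDerivAt hA (letters_admissible hx) (Finset.univ : Finset (Fin 3))
    (fun _ => 2) (fun _ t => genFun c (ratio x t)) ![0, 1, -1] (fun _ _ => hc.3) ?_ ?_
    (genFun_ratio_tendsto_zero hc.1.div_nat (by simp))
  · intro i _
    apply hA'
    fin_cases i <;> simp
  · intro t ht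
    refine (genFun_ratio_hasDerivAt hx hc.1.div_nat ht).congr_deriv ?_
    have e : (fun k : ℕ => (k : ℂ) * (c k / (k : ℂ))) = c := by
      funext k
      rcases k with _ | k
      · simp [hc.2]
      · rw [mul_div_cancel₀]
        exact_mod_cast Nat.succ_ne_zero k
    rw [e, ratio_logDeriv hx ht, ← mul_assoc, div_mul_cancel₀ _ (ratio_ne_zero hx ht)]
    simp only [Fin.sum_univ_three, Matrix.cons_val]
    push_cast
    rw [sub_neg_eq_add, sub_zero]
    ring

/-- Strict partial sums contribute `z/(1 - z)`, and `z/(1 - z) · d log z = -d log(1 - z)`. No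
condition on `c 0` is imposed, so the constant series can start the induction. -/
theorem genFun_psum_ratio_hasDerivAt (hx : 2 / (3 * Real.sqrt 3) < ‖x * (1 - x ^ 2)‖)
    (hc : PolyBounded c) {t : ℝ} (ht : t ∈ Ioo (0 : ℝ) 1) :
    HasDerivAt (fun t => genFun (fun k => (∑ j ∈ Finset.range k, c j) / (k : ℂ)) (ratio x t))
      (∑ i, ((-1 : ℚ) : ℂ) * (genFun c (ratio x t) / ((t : ℂ) - letterVec x i))) t := by
  refine (genFun_ratio_hasDerivAt hx hc.psum.div_nat ht).congr_deriv ?_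
  have e : (fun k : ℕ => (k : ℂ) * ((∑ j ∈ Finset.range k, c j) / (k : ℂ))) =
      fun k => ∑ j ∈ Finset.range k, c j := by
    funext k
    rcases k with _ | k
    · simp
    · rw [mul_div_cancel₀]
      exact_mod_cast Nat.succ_ne_zero k
  have hr := ratio_ne_zero hx ht
  rw [e, genFun_psum hc (ratio_norm_lt hx (Ioo_subset_Icc_self ht))]
  have h := ratio_logDeriv_one_sub hx ht
  calc _ = genFun c (ratio x t) * (2 * ((t : ℂ) * (1 - (t : ℂ) ^ 2)) * (1 - 3 * (t : ℂ) ^ 2) /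
        (x * (1 - x ^ 2)) ^ 2 / (1 - ratio x t)) := by
        generalize ratio x t = z at *
        generalize genFun c z = g at *
        rw [div_right_comm, mul_div_cancel_left₀ _ hr]
        ring
    _ = _ := by
        rw [h, mul_neg, Finset.mul_sum, ← Finset.sum_neg_distrib]
        refine Finset.sum_congr rfl fun i _ => ?_
        push_cast
        ring

theorem IsGplSeries.psum (hx : 2 / (3 * Real.sqrt 3) < ‖x * (1 - x ^ 2)‖)
    (hA : ∀ a ∈ A, Admissible a) (hA' : letters x ⊆ A) (hc : IsGplSeries A x n c) :
    IsGplSeries A x (n + 1) fun k => (∑ j ∈ Finset.range k, c j) / (k : ℂ) := by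
  refine ⟨hc.1.psum.div_nat, by simp, ?_⟩
  exact mem_gplFun_of_hasDerivAt hA (letters_admissible hx) Finset.univ
    (fun _ => -1) (fun _ t => genFun c (ratio x t)) (letterVec x) (fun _ _ => hc.3)
    (fun i _ => hA' (letterVec_mem x i)) (fun t ht => genFun_psum_ratio_hasDerivAt hx hc.1 ht)
    (genFun_ratio_tendsto_zero hc.1.psum.div_nat (by simp))

theorem isGplSeries_one_div (hx : 2 / (3 * Real.sqrt 3) < ‖x * (1 - x ^ 2)‖) :
    IsGplSeries A x 1 fun k => 1 / (k : ℂ) := by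
  -- The constant series 1: its strict partial sums are 1 for `k ≥ 1` and 0 for `k = 0`, so `∑ z^k/k
  -- = -log(1 - z)` falls under the general derivative formula.
  set δ : ℕ → ℂ := Pi.single 0 1 with hδ
  have hb : PolyBounded δ := by
    refine ⟨1, 0, fun k => ?_⟩
    rcases k with _ | k <;> simp [hδ]
  have e : (fun k : ℕ => 1 / (k : ℂ)) = fun k => (∑ j ∈ Finset.range k, δ j) / (k : ℂ) := by
    funext k
    rcases k with _ | k
    · simp
    · congr 1
      rw [Finset.sum_eq_single 0 (fun j _ hj => by simp [hδ, hj]) (by simp)]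
      simp [hδ]
  have hδ1 : ∀ z, genFun δ z = 1 := by
    intro z
    rw [genFun, tsum_eq_single 0 (fun k hk => by simp [hδ, hk])]
    simp [hδ]
  rw [e]
  refine ⟨hb.psum.div_nat, by simp, ?_⟩
  have hl := fun i => letters_admissible hx _ (letterVec_mem x i)
  have hadm : ∀ i, ∀ β ∈ [letterVec x i], Admissible β := fun i => by simpa using (hl i).1
  have hmem : ∑ i, (-1 : ℚ) • gpl [letterVec x i] ∈ gplFun A (letters x) 0 1 :=
    Submodule.sum_mem _ fun i _ => Submodule.smul_mem _ _
      (gpl_mem_gplFun (singleton_mem_wordSet (letterVec_mem x i)))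
  refine gplFun_congr hmem (eqOn_of_hasDerivAt
    (fun t ht => genFun_psum_ratio_hasDerivAt hx hb ht) (fun t ht => ?_)
    (genFun_ratio_tendsto_zero hb.psum.div_nat (by simp)) ?_)
  · refine (HasDerivAt.sum fun i _ => rat_smul_hasDerivAt
      (gpl_hasDerivAt (hadm i) ht) (-1)).congr_deriv ?_
    simp [hδ1, gpl_nil]
  · have : Tendsto (fun t => ∑ i, ((-1 : ℚ) : ℂ) * gpl [letterVec x i] t) (𝓝[>] 0)
        (𝓝 (∑ i : Fin 6, ((-1 : ℚ) : ℂ) * 0)) :=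
      tendsto_finsetSum _ fun i _ =>
        (gpl_tendsto_zero (hadm i) (by simpa using (hl i).2)).const_mul _
    rw [show ∑ i : Fin 6, ((-1 : ℚ) : ℂ) * 0 = 0 by simp] at this
    refine this.congr fun t => ?_
    simp

theorem isGplSeries_one_div_pow (hx : 2 / (3 * Real.sqrt 3) < ‖x * (1 - x ^ 2)‖)
    (hA : ∀ a ∈ A, Admissible a) (hA' : {0, 1, -1} ⊆ A) (r : ℕ) :
    IsGplSeries A x (r + 1) fun k => 1 / (k : ℂ) ^ (r + 1) := by
  induction r with
  | zero => simpa using isGplSeries_one_div hx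
  | succ r ih =>
    refine cast ?_ (ih.div_nat hx hA hA')
    congr 1
    funext k
    rw [div_div, ← pow_succ]

/-- Products of generalized harmonic numbers over a power of the index. -/
theorem isGplSeries_prod_genHarmonic (hx : 2 / (3 * Real.sqrt 3) < ‖x * (1 - x ^ 2)‖)
    (hA : ∀ a ∈ A, Admissible a) (hA' : {0, 1, -1} ⊆ A) (hA'' : letters x ⊆ A)
    {ι : Type*} [DecidableEq ι] (f : ι → ℕ) (hf : ∀ i, 0 < f i) (s : Finset ι) (r : ℕ) :
    IsGplSeries A x (r + 1 + ∑ i ∈ s, f i)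
      fun k => (∏ i ∈ s, (genHarmonic (f i) k : ℂ)) / (k : ℂ) ^ (r + 1) := by
  induction s using Finset.strongInduction generalizing r with
  | H s ih =>
    rcases s.eq_empty_or_nonempty with rfl | hs
    · simpa using isGplSeries_one_div_pow hx hA hA' r
    induction r with
    | succ r ihr =>
      have h := ihr.div_nat hx hA hA'
      rw [add_right_comm] at h
      refine cast ?_ h
      congr 1
      funext k
      rw [div_div, ← pow_succ]
    | zero =>
      set P : ℕ → ℂ := fun k => ∏ i ∈ s, (genHarmonic (f i) k : ℂ) with hP
      -- Backward difference `P k - P (k - 1)`, obtained by expanding `∏ (H_k - 1/k^(f i))`; the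
      -- full subset gives `P k` and cancels. In each remaining term `s \ t` is nonempty, so a
      -- positive power of `k` is available for the induction hypothesis.
      set d : ℕ → ℂ := fun k => ∑ t ∈ s.ssubsets, ((-(-1) ^ (s \ t).card : ℚ) : ℂ) *
        ((∏ i ∈ t, (genHarmonic (f i) k : ℂ)) / (k : ℂ) ^ (∑ i ∈ s \ t, f i)) with hd
      have hW : IsGplSeries A x (∑ i ∈ s, f i) d := by
        refine IsGplSeries.sum hx _ _ fun t ht => IsGplSeries.rat_mul ?_ _
        have hts := Finset.mem_ssubsets.1 ht
        obtain ⟨j, hj⟩ : (s \ t).Nonempty := Finset.sdiff_nonempty.2 hts.2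
        have hpos : 0 < ∑ i ∈ s \ t, f i :=
          (hf j).trans_le (Finset.single_le_sum (fun _ _ => Nat.zero_le _) hj)
        have := ih t hts (∑ i ∈ s \ t, f i - 1)
        rwa [Nat.sub_add_cancel hpos, Finset.sum_sdiff hts.1] at this
      have hstep : ∀ k, d (k + 1) = P (k + 1) - P k := by
        intro k
        have h1 : P k = ∏ i ∈ s, ((genHarmonic (f i) (k + 1) : ℂ) +
            -(1 / ((k + 1 : ℕ) : ℂ) ^ f i)) := by
          refine Finset.prod_congr rfl fun i _ => ?_
          simp only [genHarmonic]
          rw [Finset.sum_Icc_succ_top (by omega)]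
          push_cast
          ring
        have h2 : ∀ t, ∏ i ∈ s \ t, -(1 / ((k + 1 : ℕ) : ℂ) ^ f i) =
            (-1) ^ (s \ t).card * (1 / ((k + 1 : ℕ) : ℂ) ^ (∑ i ∈ s \ t, f i)) := by
          intro t
          rw [Finset.prod_neg, Finset.prod_div_distrib, Finset.prod_pow_eq_pow_sum,
            Finset.prod_const_one]
        rw [h1, Finset.prod_add, ← Finset.add_sum_erase _ _ (Finset.mem_powerset_self s)]
        simp only [Finset.sdiff_self, Finset.prod_empty, mul_one, h2, hP, hd, Finset.ssubsets]
        rw [sub_add_cancel_left, ← Finset.sum_neg_distrib]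
        refine Finset.sum_congr rfl fun t _ => ?_
        push_cast
        ring
      have hzero : P 0 = 0 := by
        obtain ⟨j, hj⟩ := hs
        exact Finset.prod_eq_zero hj (by simp [genHarmonic])
      have hsum : ∀ k, ∑ j ∈ Finset.range (k + 1), d j = P k := by
        intro k
        rw [Finset.sum_range_succ', hW.2, add_zero]
        simp only [hstep]
        rw [Finset.sum_range_sub, hzero, sub_zero]
      -- `P k = ∑_{j<k} d j + d k`: the strict sum and the diagonal term are divided by `k`
      -- separately.
      have h := (hW.psum hx hA hA'').add hx (hW.div_nat hx hA hA')
      rw [zero_add, add_comm 1]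
      refine cast ?_ h
      congr 1
      funext k
      rw [← add_div, ← Finset.sum_range_succ, hsum, pow_one]

end

section

/-! ### Beta integrals with logarithmic weights -/

/-- The integral of `(1 - t²)^a t^(2b) g(t)` over `(0, 1)`. -/
def betaInt (g : ℝ → ℝ) (a b : ℕ) : ℝ := ∫ t in (0 : ℝ)..1, (1 - t ^ 2) ^ a * t ^ (2 * b) * g t

/-- The sum of the reciprocals of the first `n` odd numbers. -/
def oddHarm (n : ℕ) : ℝ := ∑ i ∈ Finset.range n, 1 / (2 * (i : ℝ) + 1)

theorem harm_succ (m : ℕ) : harm (m + 1) = harm m + 1 / ((m : ℝ) + 1) := by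
  rw [harm, genHarmonic, Finset.sum_Icc_succ_top (by omega)]
  simp [harm, genHarmonic]

theorem oddHarm_succ (n : ℕ) : oddHarm (n + 1) = oddHarm n + 1 / (2 * (n : ℝ) + 1) := by
  rw [oddHarm, Finset.sum_range_succ, oddHarm]

theorem oddHarm_eq (n : ℕ) : oddHarm n = harm (2 * n) - harm n / 2 := by
  induction n with
  | zero => simp [oddHarm, harm, genHarmonic]
  | succ n ih =>
    rw [oddHarm_succ, ih, show 2 * (n + 1) = 2 * n + 1 + 1 by ring, harm_succ, harm_succ, harm_succ]
    push_cast
    field_simp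
    ring

theorem betaInt_integrable {g : ℝ → ℝ} (hg : IntervalIntegrable g volume 0 1) (a b : ℕ) :
    IntervalIntegrable (fun t => (1 - t ^ 2) ^ a * t ^ (2 * b) * g t) volume 0 1 :=
  hg.continuousOn_mul (by fun_prop)

theorem betaInt_succ_left {g : ℝ → ℝ} (hg : IntervalIntegrable g volume 0 1) (a b : ℕ) :
    betaInt g (a + 1) b = betaInt g a b - betaInt g a (b + 1) := by
  rw [betaInt, betaInt, betaInt, ← intervalIntegral.integral_sub (betaInt_integrable hg _ _)
    (betaInt_integrable hg _ _)]
  refine intervalIntegral.integral_congr fun t _ => ?_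
  ring

theorem one_intervalIntegrable : IntervalIntegrable (fun _ => 1 : ℝ → ℝ) volume 0 1 :=
  intervalIntegrable_const

theorem log_intervalIntegrable : IntervalIntegrable Real.log volume 0 1 :=
  intervalIntegral.intervalIntegrable_log'

theorem log_one_sub_sq {t : ℝ} (ht : t ∈ Ioo (0 : ℝ) 1) :
    Real.log (1 - t ^ 2) = Real.log (1 - t) + Real.log (1 + t) := by
  rw [← Real.log_mul (by linarith [ht.2]) (by linarith [ht.1])]
  congr 1
  ring

theorem log_one_sub_sq_intervalIntegrable :
    IntervalIntegrable (fun t => Real.log (1 - t ^ 2)) volume 0 1 := by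
  have h1 : IntervalIntegrable (fun t => Real.log (1 - t)) volume 0 1 := by
    simpa using (log_intervalIntegrable.comp_sub_left 1).symm
  have h2 : IntervalIntegrable (fun t : ℝ => Real.log (1 + t)) volume 0 1 := by
    refine ContinuousOn.intervalIntegrable fun t ht => ?_
    rw [uIcc_of_le zero_le_one] at ht
    exact ContinuousAt.continuousWithinAt (ContinuousAt.log (by fun_prop) (by linarith [ht.1]))
  refine (h1.add h2).congr_uIoo ?_
  intro t ht
  rw [uIoo_of_le zero_le_one] at ht
  exact (log_one_sub_sq ht).symm

/-- The function `(1 - t²)^(a+1) t^(2b+1)` vanishes at both endpoints. Together with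
`betaInt_succ_left` this gives a first-order recurrence in `a`. -/
theorem betaInt_parts (a b : ℕ) :
    (2 * b + 1) * betaInt (fun _ => 1) (a + 1) b = 2 * (a + 1) * betaInt (fun _ => 1) a (b + 1) := by
  have h := intervalIntegral.integral_eq_sub_of_hasDerivAt_of_le (zero_le_one' ℝ)
    (f := fun t : ℝ => (1 - t ^ 2) ^ (a + 1) * t ^ (2 * b + 1))
    (f' := fun t : ℝ => (2 * b + 1) * ((1 - t ^ 2) ^ (a + 1) * t ^ (2 * b) * 1) -
      2 * (a + 1) * ((1 - t ^ 2) ^ a * t ^ (2 * (b + 1)) * 1)) (by fun_prop)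
    (fun t _ => by
      refine ((((hasDerivAt_pow 2 t).const_sub 1).fun_pow (a + 1)).mul
        (hasDerivAt_pow (2 * b + 1) t)).congr_deriv ?_
      simp only [Nat.add_sub_cancel]
      push_cast
      ring)
    (((betaInt_integrable one_intervalIntegrable _ _).const_mul _).sub
      ((betaInt_integrable one_intervalIntegrable _ _).const_mul _))
  rw [intervalIntegral.integral_sub
    ((betaInt_integrable one_intervalIntegrable _ _).const_mul _)
      ((betaInt_integrable one_intervalIntegrable _ _).const_mul _),
    intervalIntegral.integral_const_mul, intervalIntegral.integral_const_mul] at h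
  simp only [betaInt]
  norm_num at h ⊢
  linarith

theorem betaInt_zero (b : ℕ) : (2 * b + 1) * betaInt (fun _ => 1) 0 b = 1 := by
  simp only [betaInt, pow_zero, one_mul, mul_one, integral_pow]
  push_cast
  field_simp
  simp

theorem betaInt_succ (a b : ℕ) : (2 * a + 2 * b + 3) * betaInt (fun _ => 1) (a + 1) b =
    2 * (a + 1) * betaInt (fun _ => 1) a b := by
  have h1 := betaInt_succ_left one_intervalIntegrable a b
  have h2 := betaInt_parts a b
  linear_combination h2 + 2 * (a + 1) * h1

/-- This is `½ B(a+1, b+½)`, with the half-integer Gamma values written through factorials. -/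
theorem betaInt_factorial (a b : ℕ) :
    betaInt (fun _ => 1) a b * (b.factorial * (2 * (a + b + 1)).factorial) =
      2 ^ (2 * a + 1) * a.factorial * (2 * b).factorial * (a + b + 1).factorial := by
  induction a with
  | zero =>
    have h := betaInt_zero b
    rw [zero_add, show 2 * (b + 1) = 2 * b + 1 + 1 by ring, Nat.factorial_succ (2 * b + 1),
      Nat.factorial_succ (2 * b), Nat.factorial_succ b]
    push_cast
    simp only [Nat.factorial_zero]
    push_cast
    linear_combination (b.factorial * (2 * b + 1 + 1) * (2 * b).factorial : ℝ) * h
  | succ a ih =>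
    have h := betaInt_succ a b
    rw [show 2 * (a + 1 + b + 1) = 2 * (a + b + 1) + 1 + 1 by ring,
      show a + 1 + b + 1 = a + b + 1 + 1 by ring, Nat.factorial_succ (2 * (a + b + 1) + 1),
      Nat.factorial_succ (2 * (a + b + 1)), Nat.factorial_succ (a + b + 1), Nat.factorial_succ a]
    push_cast
    linear_combination (b.factorial * (2 * (a + b + 1)).factorial * (2 * (a + b + 1) + 1 + 1) : ℝ) *
      h + (2 * (a + 1) * (2 * (a + b + 1) + 1 + 1)) * ih

/-! ### The weight `log t` -/

theorem betaInt_log_zero (b : ℕ) :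
    (2 * b + 1) * betaInt Real.log 0 b = -betaInt (fun _ => 1) 0 b := by
  have h := intervalIntegral.integral_eq_sub_of_hasDerivAt_of_le (zero_le_one' ℝ)
    -- Grouping `t * log t` keeps the primitive continuous at 0, where `Real.log 0 = 0`.
    (f := fun t : ℝ => t ^ (2 * b) * (t * Real.log t))
    (f' := fun t : ℝ => (2 * b + 1) * ((1 - t ^ 2) ^ 0 * t ^ (2 * b) * Real.log t) +
      (1 - t ^ 2) ^ 0 * t ^ (2 * b) * 1)
    ((by fun_prop : Continuous fun t : ℝ => t ^ (2 * b)).mul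
      Real.continuous_mul_log).continuousOn
    (fun t ht => by
      refine ((hasDerivAt_pow (2 * b) t).mul ((hasDerivAt_id t).mul
        (Real.hasDerivAt_log ht.1.ne'))).congr_deriv ?_
      have : t ≠ 0 := ht.1.ne'
      rcases b with _ | b
      · simp [this, add_comm]
      · rw [show 2 * (b + 1) - 1 = 2 * b + 1 by omega]
        simp only [Pi.mul_apply, id]
        push_cast
        field_simp
        ring)
    (((betaInt_integrable log_intervalIntegrable _ _).const_mul _).add
      (betaInt_integrable one_intervalIntegrable _ _))
  rw [intervalIntegral.integral_add
    ((betaInt_integrable log_intervalIntegrable _ _).const_mul _)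
      (betaInt_integrable one_intervalIntegrable _ _), intervalIntegral.integral_const_mul] at h
  simp only [Real.log_one, Real.log_zero, mul_zero, sub_zero] at h
  exact eq_neg_of_add_eq_zero_left h

theorem betaInt_log_parts (a b : ℕ) :
    (2 * b + 1) * betaInt Real.log (a + 1) b + betaInt (fun _ => 1) (a + 1) b =
      2 * (a + 1) * betaInt Real.log a (b + 1) := by
  have i1 := (betaInt_integrable log_intervalIntegrable (a + 1) b).const_mul (2 * (b : ℝ) + 1)
  have i2 := (betaInt_integrable log_intervalIntegrable a (b + 1)).const_mul (2 * ((a : ℝ) + 1))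
  have i3 := betaInt_integrable one_intervalIntegrable (a + 1) b
  have h := intervalIntegral.integral_eq_sub_of_hasDerivAt_of_le (zero_le_one' ℝ)
    (f := fun t : ℝ => ((1 - t ^ 2) ^ (a + 1) * t ^ (2 * b)) * (t * Real.log t))
    ((by fun_prop : Continuous fun t : ℝ => (1 - t ^ 2) ^ (a + 1) * t ^ (2 * b)).mul
      Real.continuous_mul_log).continuousOn
    (fun t ht => by
      refine (((((hasDerivAt_pow 2 t).const_sub 1).fun_pow (a + 1)).mul
        (hasDerivAt_pow (2 * b) t)).mul ((hasDerivAt_id t).mul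
        (Real.hasDerivAt_log ht.1.ne'))).congr_deriv
          (?_ : _ = (2 * b + 1) * ((1 - t ^ 2) ^ (a + 1) * t ^ (2 * b) * Real.log t) +
      (1 - t ^ 2) ^ (a + 1) * t ^ (2 * b) * 1 -
      2 * (a + 1) * ((1 - t ^ 2) ^ a * t ^ (2 * (b + 1)) * Real.log t))
      have : t ≠ 0 := ht.1.ne'
      rcases b with _ | b
      · simp only [Pi.mul_apply, id, Nat.add_sub_cancel]
        field_simp
        push_cast
        ring
      · rw [show 2 * (b + 1) - 1 = 2 * b + 1 by omega]
        simp only [Pi.mul_apply, id, Nat.add_sub_cancel]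
        push_cast
        field_simp
        ring)
    ((i1.add i3).sub i2)
  rw [intervalIntegral.integral_sub (i1.add i3) i2, intervalIntegral.integral_add i1 i3,
    intervalIntegral.integral_const_mul, intervalIntegral.integral_const_mul] at h
  simp only [Real.log_one, Real.log_zero, mul_zero, sub_zero] at h
  exact sub_eq_zero.1 h

/-- Half the `b`-derivative of `½ B(a+1, b+½)`: the digamma difference `ψ(b+½) - ψ(a+b+3/2)` is a
finite sum of odd reciprocals. The proof uses recurrences only. -/
theorem betaInt_log (a b : ℕ) : betaInt Real.log a b =
    -(oddHarm (a + b + 1) - oddHarm b) * betaInt (fun _ => 1) a b := by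
  induction a with
  | zero =>
    have h := betaInt_log_zero b
    have hb : (2 * (b : ℝ) + 1) ≠ 0 := by positivity
    rw [zero_add, oddHarm_succ]
    field_simp
    linear_combination h
  | succ a ih =>
    have h1 := betaInt_log_parts a b
    have h2 := betaInt_succ_left log_intervalIntegrable a b
    have h3 := betaInt_succ a b
    have hne : (2 * (a : ℝ) + 2 * b + 3) ≠ 0 := by positivity
    have hne' : (2 * ((a : ℝ) + b + 1) + 1) ≠ 0 := by positivity
    rw [show a + 1 + b + 1 = a + b + 1 + 1 by ring, oddHarm_succ]
    push_cast
    refine mul_left_cancel₀ hne ?_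
    have e : (2 * (a : ℝ) + 2 * b + 3) * (1 / (2 * ((a : ℝ) + b + 1) + 1)) = 1 := by
      field_simp
      ring
    linear_combination h1 + 2 * (a + 1) * h2 + 2 * (a + 1) * ih -
      (oddHarm b - oddHarm (a + b + 1)) * h3 + betaInt (fun _ => 1) (a + 1) b * e

/-! ### The weight `log (1 - t²)` -/

theorem continuous_one_sub_sq_mul_log :
    Continuous fun t : ℝ => (1 - t ^ 2) * Real.log (1 - t ^ 2) :=
  Real.continuous_mul_log.comp (by fun_prop : Continuous fun t : ℝ => 1 - t ^ 2)

theorem one_sub_sq_hasDerivAt_log {t : ℝ} (ht : t ∈ Ioo (0 : ℝ) 1) :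
    (1 - t ^ 2 ≠ 0) ∧
    HasDerivAt (fun t : ℝ => (1 - t ^ 2) * Real.log (1 - t ^ 2))
      (-2 * t * Real.log (1 - t ^ 2) - 2 * t) t := by
  have hne : 1 - t ^ 2 ≠ 0 := by nlinarith [ht.1, ht.2]
  have hd : HasDerivAt (fun t : ℝ => 1 - t ^ 2) (-(2 * t)) t := by
    simpa using (hasDerivAt_pow 2 t).const_sub 1
  refine ⟨hne, (hd.mul (hd.log hne)).congr_deriv ?_⟩
  field_simp
  ring

theorem betaInt_log_one_sub_parts (a b : ℕ) :
    (2 * b + 1) * betaInt (fun t => Real.log (1 - t ^ 2)) (a + 1) b =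
      2 * (a + 1) * betaInt (fun t => Real.log (1 - t ^ 2)) a (b + 1) +
        2 * betaInt (fun _ => 1) a (b + 1) := by
  have i1 := (betaInt_integrable log_one_sub_sq_intervalIntegrable (a + 1) b).const_mul
    (2 * (b : ℝ) + 1)
  have i2 := (betaInt_integrable log_one_sub_sq_intervalIntegrable a (b + 1)).const_mul
    (2 * ((a : ℝ) + 1))
  have i3 := (betaInt_integrable one_intervalIntegrable a (b + 1)).const_mul 2
  have h := intervalIntegral.integral_eq_sub_of_hasDerivAt_of_le (zero_le_one' ℝ)
    -- One factor `1 - t²` stays with the logarithm, so the primitive is continuous and zero at 1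
    -- even for `a = 0`.
    (f := fun t : ℝ => ((1 - t ^ 2) ^ a * t ^ (2 * b + 1)) *
      ((1 - t ^ 2) * Real.log (1 - t ^ 2)))
    ((by fun_prop : Continuous fun t : ℝ => (1 - t ^ 2) ^ a * t ^ (2 * b + 1)).mul
      continuous_one_sub_sq_mul_log).continuousOn
    (fun t ht => by
      refine (((((hasDerivAt_pow 2 t).const_sub 1).fun_pow a).mul
        (hasDerivAt_pow (2 * b + 1) t)).mul (one_sub_sq_hasDerivAt_log ht).2).congr_deriv
          (?_ : _ = (2 * b + 1) * ((1 - t ^ 2) ^ (a + 1) * t ^ (2 * b) * Real.log (1 - t ^ 2)) -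
      2 * (a + 1) * ((1 - t ^ 2) ^ a * t ^ (2 * (b + 1)) * Real.log (1 - t ^ 2)) -
      2 * ((1 - t ^ 2) ^ a * t ^ (2 * (b + 1)) * 1))
      rcases a with _ | a
      · simp only [Pi.mul_apply, Nat.add_sub_cancel]
        push_cast
        ring
      · simp only [Pi.mul_apply, Nat.add_sub_cancel]
        push_cast
        ring)
    ((i1.sub i2).sub i3)
  rw [intervalIntegral.integral_sub (i1.sub i2) i3, intervalIntegral.integral_sub i1 i2,
    intervalIntegral.integral_const_mul, intervalIntegral.integral_const_mul,
    intervalIntegral.integral_const_mul] at h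
  norm_num at h
  simp only [betaInt, mul_one]
  linarith

theorem betaInt_log_one_sub_zero_succ (b : ℕ) :
    (2 * b + 1) * betaInt (fun t => Real.log (1 - t ^ 2)) 0 b =
      (2 * b + 3) * betaInt (fun t => Real.log (1 - t ^ 2)) 0 (b + 1) +
        2 * betaInt (fun _ => 1) 0 (b + 1) := by
  have h1 := betaInt_log_one_sub_parts 0 b
  have h2 := betaInt_succ_left log_one_sub_sq_intervalIntegrable 0 b
  push_cast at h1
  linear_combination h1 - (2 * b + 1) * h2

theorem betaInt_log_one_sub_zero_zero :
    betaInt (fun t => Real.log (1 - t ^ 2)) 0 0 = 2 * Real.log 2 - 2 := by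
  have hc : Continuous fun t : ℝ => (1 + t) * Real.log (1 + t) -
      (1 - t) * Real.log (1 - t) - 2 * t :=
    ((Real.continuous_mul_log.comp (by fun_prop : Continuous fun t : ℝ => 1 + t)).sub
      (Real.continuous_mul_log.comp (by fun_prop : Continuous fun t : ℝ => 1 - t))).sub
      (by fun_prop)
  have h := intervalIntegral.integral_eq_sub_of_hasDerivAt_of_le (zero_le_one' ℝ)
    (f' := fun t => (1 - t ^ 2) ^ 0 * t ^ (2 * 0) * Real.log (1 - t ^ 2)) hc.continuousOn
    (fun t ht => by
      have n1 : 1 + t ≠ 0 := by linarith [ht.1]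
      have n2 : 1 - t ≠ 0 := by linarith [ht.2]
      have d1 := (hasDerivAt_id t).const_add 1
      have d2 := (hasDerivAt_id t).const_sub 1
      refine (((d1.mul (d1.log n1)).sub (d2.mul (d2.log n2))).sub
        ((hasDerivAt_id t).const_mul 2)).congr_deriv ?_
      rw [log_one_sub_sq ht]
      simp only [id]
      field_simp
      ring)
    (betaInt_integrable log_one_sub_sq_intervalIntegrable 0 0)
  rw [betaInt, h]
  norm_num

theorem betaInt_log_one_sub_zero (b : ℕ) :
    (2 * b + 1) * betaInt (fun t => Real.log (1 - t ^ 2)) 0 b =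
      2 * Real.log 2 - 2 * oddHarm (b + 1) := by
  induction b with
  | zero => simp [betaInt_log_one_sub_zero_zero, oddHarm]
  | succ b ih =>
    have h1 := betaInt_log_one_sub_zero_succ b
    have h2 := betaInt_zero (b + 1)
    rw [oddHarm_succ]
    push_cast at h2 ⊢
    have h3 : betaInt (fun _ => 1) 0 (b + 1) = 1 / (2 * ((b : ℝ) + 1) + 1) := by
      rw [eq_div_iff (by positivity)]
      linarith
    linear_combination ih - h1 - 2 * h3

/-- The `a`-derivative of `½ B(a+1, b+½)`, with factor `ψ(a+1) - ψ(a+b+3/2)`; the term `2 log 2`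
comes from the digamma function at half-integers. -/
theorem betaInt_log_one_sub (a b : ℕ) : betaInt (fun t => Real.log (1 - t ^ 2)) a b =
    (2 * Real.log 2 + harm a - 2 * oddHarm (a + b + 1)) * betaInt (fun _ => 1) a b := by
  induction a with
  | zero =>
    have h := betaInt_log_one_sub_zero b
    have h2 := betaInt_zero b
    have hb : (2 * (b : ℝ) + 1) ≠ 0 := by positivity
    refine mul_left_cancel₀ hb ?_
    rw [zero_add, show harm 0 = 0 by simp [harm, genHarmonic]]
    linear_combination h - (2 * Real.log 2 - 2 * oddHarm (b + 1)) * h2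
  | succ a ih =>
    have h1 := betaInt_log_one_sub_parts a b
    have h2 := betaInt_succ_left log_one_sub_sq_intervalIntegrable a b
    have h3 := betaInt_succ a b
    have h4 := betaInt_parts a b
    have hne : (2 * (a : ℝ) + 2 * b + 3) ≠ 0 := by positivity
    have hne' : (2 * ((a : ℝ) + b + 1) + 1) ≠ 0 := by positivity
    have hne'' : ((a : ℝ) + 1) ≠ 0 := by positivity
    rw [show a + 1 + b + 1 = a + b + 1 + 1 by ring, oddHarm_succ, harm_succ]
    push_cast
    refine mul_left_cancel₀ hne ?_
    have e : (2 * (a : ℝ) + 2 * b + 3) * (1 / (2 * ((a : ℝ) + b + 1) + 1)) = 1 := by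
      field_simp
      ring
    have e2 : (2 * (a : ℝ) + 2 * b + 3) * (1 / ((a : ℝ) + 1)) = 2 + (2 * b + 1) / (a + 1) := by
      field_simp
      ring
    have e3 : 2 * betaInt (fun _ => 1) a (b + 1) =
        (2 * b + 1) / (a + 1) * betaInt (fun _ => 1) (a + 1) b := by
      field_simp
      linear_combination -h4
    linear_combination h1 + 2 * (a + 1) * h2 + 2 * (a + 1) * ih -
      (2 * Real.log 2 + harm a - 2 * oddHarm (a + b + 1)) * h3 +
      betaInt (fun _ => 1) (a + 1) b * (2 * e - e2) + e3

end

section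

/-! ### From the series to the integral -/

variable {x : ℂ}

theorem genFun_eq_tsum_succ {c : ℕ → ℂ} (hc : PolyBounded c) (h0 : c 0 = 0) {z : ℂ}
    (hz : ‖z‖ < 1) : genFun c z = ∑' j, c (j + 1) * z ^ (j + 1) := by
  rw [genFun, (hc.summable_mul_pow hz).tsum_eq_zero_add, h0, zero_mul, zero_add]

theorem one_sub_sq_ne_zero {t : ℝ} (ht : t ∈ Ioo (0 : ℝ) 1) : (1 : ℂ) - (t : ℂ) ^ 2 ≠ 0 := by
  obtain ⟨-, h1, h2⟩ := ofReal_ne ht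
  rw [show (1 : ℂ) - (t : ℂ) ^ 2 = -((t - 1) * (t + 1)) by ring]
  exact neg_ne_zero.2 (mul_ne_zero h1 h2)

/-- The integrand of the `(j + 1)`-st term. -/
def termFun (c : ℕ → ℂ) (x : ℂ) (g : ℝ → ℝ) (j : ℕ) (t : ℝ) : ℂ :=
  4 * c (j + 1) / (x * (1 - x ^ 2)) ^ (2 * (j + 1)) *
    (((1 - t ^ 2) ^ (2 * j + 1) * t ^ (2 * (j + 1)) * g t : ℝ) : ℂ)

theorem termFun_eq (c : ℕ → ℂ) (x : ℂ) (g : ℝ → ℝ) (j : ℕ) {t : ℝ} (ht : t ∈ Ioo (0 : ℝ) 1) :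
    termFun c x g j t =
      c (j + 1) * ratio x t ^ (j + 1) * (4 / (1 - (t : ℂ) ^ 2) * (g t : ℂ)) := by
  have h := one_sub_sq_ne_zero ht
  rw [termFun, ratio]
  push_cast
  rw [← pow_mul, div_pow, mul_pow, show 2 * (j + 1) = 2 * j + 1 + 1 by ring,
    pow_succ (1 - (t : ℂ) ^ 2)]
  field_simp
  rw [mul_pow]
  ring

/-- One factor `z(t)` absorbs the pole of `4/(1 - t²)` at 1, since it carries `(1 - t²)²`; hence `q
^ j` and not `q ^ (j + 1)`. -/
theorem termFun_norm_le {c : ℕ → ℂ} {g : ℝ → ℝ} {q : ℝ}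
    (hq : ∀ t ∈ Icc (0 : ℝ) 1, ‖ratio x t‖ ≤ q) (j : ℕ) {t : ℝ} (ht : t ∈ Ioo (0 : ℝ) 1) :
    ‖termFun c x g j t‖ ≤
      ‖c (j + 1)‖ * q ^ j * (4 / ‖x * (1 - x ^ 2)‖ ^ 2) * ‖g t‖ := by
  have h := one_sub_sq_ne_zero ht
  have h1 : ratio x t * (4 / (1 - (t : ℂ) ^ 2)) =
      (t : ℂ) ^ 2 * (1 - (t : ℂ) ^ 2) * (4 / (x * (1 - x ^ 2)) ^ 2) := by
    rw [ratio, div_pow, mul_pow]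
    field_simp
  have h2 : ‖(t : ℂ) ^ 2 * (1 - (t : ℂ) ^ 2)‖ ≤ 1 := by
    have e : (t : ℂ) ^ 2 * (1 - (t : ℂ) ^ 2) = ((t ^ 2 * (1 - t ^ 2) : ℝ) : ℂ) := by
      push_cast; rfl
    have h3 : 0 ≤ 1 - t ^ 2 := by nlinarith [ht.1, ht.2]
    rw [e, Complex.norm_real, Real.norm_eq_abs, abs_of_nonneg (by positivity)]
    nlinarith [sq_nonneg t]
  have h3 : termFun c x g j t = c (j + 1) * ratio x t ^ j *
      ((t : ℂ) ^ 2 * (1 - (t : ℂ) ^ 2) * (4 / (x * (1 - x ^ 2)) ^ 2)) * (g t : ℂ) := by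
    rw [termFun_eq c x g j ht, ← h1]
    ring
  rw [h3, norm_mul, norm_mul, norm_mul, norm_mul _ (4 / _), norm_pow, norm_div, norm_pow,
    Complex.norm_real]
  have h4 := hq t (Ioo_subset_Icc_self ht)
  have hq0 := (norm_nonneg _).trans h4
  have h5 : ‖(4 : ℂ)‖ = 4 := by simp
  rw [h5]
  calc ‖c (j + 1)‖ * ‖ratio x t‖ ^ j * (‖(t : ℂ) ^ 2 * (1 - (t : ℂ) ^ 2)‖ *
        (4 / ‖x * (1 - x ^ 2)‖ ^ 2)) * ‖g t‖
      ≤ ‖c (j + 1)‖ * q ^ j * (1 * (4 / ‖x * (1 - x ^ 2)‖ ^ 2)) * ‖g t‖ := by gcongr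
    _ = _ := by rw [one_mul]

theorem termFun_integral (c : ℕ → ℂ) (x : ℂ) (g : ℝ → ℝ) (j : ℕ) :
    ∫ t in Ioo (0 : ℝ) 1, termFun c x g j t =
      4 * c (j + 1) * (betaInt g (2 * j + 1) (j + 1) : ℂ) /
        (x * (1 - x ^ 2)) ^ (2 * (j + 1)) := by
  rw [← integral_Ioc_eq_integral_Ioo, ← intervalIntegral.integral_of_le zero_le_one]
  simp only [termFun]
  rw [intervalIntegral.integral_const_mul, intervalIntegral.integral_ofReal, ← betaInt]
  ring

/-- Each term is an integral and the bounds `‖c_(j+1)‖ q^j ∫|g|` are summable, so sum and integral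
may be exchanged. The integral is then the value at 1 of a primitive that again lies in `gplFun`,
one weight higher. -/
theorem seriesMem_of_betaInt (hx : 2 / (3 * Real.sqrt 3) < ‖x * (1 - x ^ 2)‖) {S : Set ℂ}
    (hA : ∀ a ∈ ({0, 1} ∪ S : Set ℂ), Admissible a) (hS : -1 ∈ S) {c : ℕ → ℂ}
    (hc : PolyBounded c) (hc0 : c 0 = 0) {g : ℝ → ℝ} (hg : IntervalIntegrable g volume 0 1)
    {n m k r : ℕ} {a : ℕ → ℝ}
    (hF : (fun t => genFun c (ratio x t) * (g t : ℂ)) ∈ gplFun ({0, 1} ∪ S) (letters x) k n)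
    (hm : m + k ≤ n + 1)
    (hterm : ∀ j, summand a r x (j + 1) = 4 * c (j + 1) *
      (betaInt g (2 * j + 1) (j + 1) : ℂ) / (x * (1 - x ^ 2)) ^ (2 * (j + 1))) :
    SeriesMem a r x (gplSpace (n + 1) m S (letters x)) := by
  have hT := letters_admissible hx
  obtain ⟨q, hq0, hq1, hq⟩ := exists_ratio_bound hx
  set D : ℝ := 4 / ‖x * (1 - x ^ 2)‖ ^ 2 with hD
  have hs : Summable fun j => ‖c (j + 1)‖ * q ^ j * D := by
    refine Summable.mul_right _ ?_
    rcases hq0.eq_or_lt with rfl | hq0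
    · refine summable_of_ne_finset_zero (s := {0}) fun j hj => ?_
      simp [show j ≠ 0 by simpa using hj]
    · have := ((summable_nat_add_iff 1).2 (hc.summable hq0.le hq1)).mul_right q⁻¹
      refine this.congr fun j => ?_
      rw [pow_succ]; field_simp
  have hgI : IntegrableOn g (Ioo 0 1) :=
    ((intervalIntegrable_iff_integrableOn_Ioo_of_le zero_le_one).1 hg)
  have hint : ∀ j, IntegrableOn (termFun c x g j) (Ioo 0 1) := by
    intro j
    have h1 := (intervalIntegrable_iff_integrableOn_Ioo_of_le zero_le_one).1
      (betaInt_integrable hg (2 * j + 1) (j + 1))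
    exact h1.ofReal.const_mul _
  have hbound : ∀ j, ∀ t ∈ Ioo (0 : ℝ) 1,
      ‖termFun c x g j t‖ ≤ ‖c (j + 1)‖ * q ^ j * D * ‖g t‖ :=
    fun j t ht => termFun_norm_le hq j ht
  have hsum : Summable fun j => ∫ t in Ioo (0 : ℝ) 1, ‖termFun c x g j t‖ := by
    refine Summable.of_nonneg_of_le (fun j => integral_nonneg fun t => norm_nonneg _)
      (fun j => ?_) (hs.mul_right (∫ t in Ioo (0 : ℝ) 1, ‖g t‖))
    rw [← integral_const_mul]
    exact setIntegral_mono_on (hint j).norm (hgI.norm.const_mul _) measurableSet_Ioo (hbound j)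
  have hmain := hasSum_integral_of_summable_integral_norm hint hsum
  simp only [termFun_integral, ← hterm] at hmain
  refine ⟨hmain.summable, ?_⟩
  rw [hmain.tsum_eq]
  set F : ℝ → ℂ := fun t => genFun c (ratio x t) * (g t : ℂ) with hFdef
  set E : ℝ → ℂ := fun t => F t * (4 / (1 - (t : ℂ) ^ 2)) with hE
  have hEt : ∀ t ∈ Ioo (0 : ℝ) 1, ∑' j, termFun c x g j t = E t := by
    intro t ht
    simp only [fun j => termFun_eq c x g j ht]
    rw [tsum_mul_right, ← genFun_eq_tsum_succ hc hc0 (ratio_norm_lt hx (Ioo_subset_Icc_self ht))]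
    simp only [hE, hFdef]
    ring
  have hEc : ContinuousOn E (Ioo 0 1) := by
    refine (gplFun_continuousOn hA hT hF).mul (ContinuousOn.div continuousOn_const (by fun_prop) ?_)
    exact fun t ht => one_sub_sq_ne_zero ht
  have hEI : IntervalIntegrable E volume 0 1 := by
    rw [intervalIntegrable_iff_integrableOn_Ioo_of_le zero_le_one]
    refine Integrable.mono' (hgI.norm.const_mul (∑' j, ‖c (j + 1)‖ * q ^ j * D))
      (hEc.aestronglyMeasurable measurableSet_Ioo) ?_
    refine (ae_restrict_iff' measurableSet_Ioo).2 (Eventually.of_forall fun t ht => ?_)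
    rw [← hEt t ht]
    exact tsum_of_norm_bounded (hs.hasSum.mul_right _) fun j => hbound j t ht
  have hEz : ∀ z ∈ Ioo (0 : ℝ) 1, IntervalIntegrable E volume 0 z := fun z hz =>
    hEI.mono_set (by
      rw [uIcc_of_le hz.1.le, uIcc_of_le zero_le_one]
      exact Icc_subset_Icc le_rfl hz.2.le)
  set J : ℝ → ℂ := fun z => ∫ t in (0 : ℝ)..z, E t with hJ
  have hJc : ContinuousOn J (Icc 0 1) := by
    have := intervalIntegral.continuousOn_primitive_interval' hEI (a := 0) (by simp)
    rwa [uIcc_of_le zero_le_one] at this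
  have hJ0 : Tendsto J (𝓝[>] 0) (𝓝 0) := by
    have h1 := (hJc 0 (by simp)).tendsto
    rw [show J 0 = 0 by simp [hJ]] at h1
    rw [← nhdsWithin_Ioo_eq_nhdsGT (zero_lt_one' ℝ)]
    exact h1.mono_left (nhdsWithin_mono _ Ioo_subset_Icc_self)
  have hJ1 : Tendsto J (𝓝[<] 1) (𝓝 (J 1)) := by
    have h1 := (hJc 1 (by simp)).tendsto
    rw [← nhdsWithin_Ioo_eq_nhdsLT (zero_lt_one' ℝ)]
    exact h1.mono_left (nhdsWithin_mono _ Ioo_subset_Icc_self)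
  have hJmem : J ∈ gplFun ({0, 1} ∪ S) (letters x) k (n + 1) := by
    refine mem_gplFun_of_hasDerivAt hA hT (Finset.univ : Finset (Fin 2)) ![2, -2] (fun _ => F)
      ![-1, 1] (fun _ _ => hF) ?_ ?_ hJ0
    · intro i _
      fin_cases i
      · exact Or.inr hS
      · exact Or.inl (by simp)
    · intro t ht
      refine (integral_hasDerivAt hEc hEz ht).congr_deriv ?_
      obtain ⟨-, h1, h2⟩ := ofReal_ne ht
      have h3 := one_sub_sq_ne_zero ht
      -- The partial fractions prepend the letters `-1` and `1`.
      have e : 4 / (1 - (t : ℂ) ^ 2) = 2 / ((t : ℂ) + 1) - 2 / ((t : ℂ) - 1) := by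
        field_simp
        ring
      simp only [hE, Fin.sum_univ_two, Matrix.cons_val_zero, Matrix.cons_val_one, e]
      push_cast
      rw [sub_neg_eq_add]
      ring
  have hval : ∫ t in Ioo (0 : ℝ) 1, ∑' j, termFun c x g j t = J 1 := by
    rw [setIntegral_congr_fun measurableSet_Ioo hEt, hJ]
    simp only
    rw [intervalIntegral.integral_of_le zero_le_one, integral_Ioc_eq_integral_Ioo]
  rw [hval]
  exact span_le_gplSpace hm (limit_mem_span hA hT hJmem hJ1)

/-! ### The terms of the series -/

/-- With `k = j + 1`, the exponent `2k - 1` of `1 - t²` produces `(2k-1)! = (2k)!/(2k)`. This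
accounts for one of the `r + 2` powers of `k` in the summand. -/
theorem summand_eq (a : ℕ → ℝ) (r : ℕ) (x : ℂ) (j : ℕ) :
    summand a (r + 1) x (j + 1) = 4 * (a (j + 1) / ((j + 1 : ℕ) : ℂ) ^ (r + 1)) *
      (betaInt (fun _ => 1) (2 * j + 1) (j + 1) : ℂ) / (x * (1 - x ^ 2)) ^ (2 * (j + 1)) := by
  have hb := betaInt_factorial (2 * j + 1) (j + 1)
  rw [show 2 * j + 1 + (j + 1) + 1 = 3 * (j + 1) by ring,
    show 2 * (3 * (j + 1)) = 6 * (j + 1) by ring] at hb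
  have c1 : ((2 * (j + 1)).choose (j + 1) : ℂ) =
      (2 * (j + 1)).factorial / ((j + 1).factorial * (j + 1).factorial) := by
    rw [Nat.cast_choose ℂ (by omega), show 2 * (j + 1) - (j + 1) = j + 1 by omega]
  have c2 : ((3 * (j + 1)).choose (j + 1) : ℂ) =
      (3 * (j + 1)).factorial / ((j + 1).factorial * (2 * (j + 1)).factorial) := by
    rw [Nat.cast_choose ℂ (by omega), show 3 * (j + 1) - (j + 1) = 2 * (j + 1) by omega]
  have c3 : ((6 * (j + 1)).choose (3 * (j + 1)) : ℂ) =
      (6 * (j + 1)).factorial / ((3 * (j + 1)).factorial * (3 * (j + 1)).factorial) := by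
    rw [Nat.cast_choose ℂ (by omega), show 6 * (j + 1) - 3 * (j + 1) = 3 * (j + 1) by omega]
  have hf : ((2 * (j + 1)).factorial : ℂ) = 2 * ((j : ℂ) + 1) * (2 * j + 1).factorial := by
    rw [show 2 * (j + 1) = 2 * j + 1 + 1 by ring, Nat.factorial_succ]
    push_cast
    ring
  have hbC := congrArg (fun y : ℝ => (y : ℂ)) hb
  push_cast at hbC
  have n1 : ((j + 1).factorial : ℂ) ≠ 0 := by exact_mod_cast Nat.factorial_ne_zero _
  have n2 : ((6 * (j + 1)).factorial : ℂ) ≠ 0 := by exact_mod_cast Nat.factorial_ne_zero _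
  have n3 : ((3 * (j + 1)).factorial : ℂ) ≠ 0 := by exact_mod_cast Nat.factorial_ne_zero _
  have n4 : ((2 * j + 1).factorial : ℂ) ≠ 0 := by exact_mod_cast Nat.factorial_ne_zero _
  have n5 : ((j : ℂ) + 1) ≠ 0 := by exact_mod_cast Nat.succ_ne_zero j
  have hbv : (betaInt (fun _ => 1) (2 * j + 1) (j + 1) : ℂ) =
      2 ^ (2 * (2 * j + 1) + 1) * (2 * j + 1).factorial * (2 * (j + 1)).factorial *
        (3 * (j + 1)).factorial / ((j + 1).factorial * (6 * (j + 1)).factorial) := by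
    rw [eq_div_iff (mul_ne_zero n1 n2)]
    exact hbC
  rw [summand, c1, c2, c3, hbv, hf, div_pow, ← pow_mul]
  push_cast
  generalize (x * (1 - x ^ 2)) ^ (2 * (j + 1)) = Y
  have h2 : (2 : ℂ) ^ (2 * (2 * (j + 1))) = 2 * 2 ^ (2 * (2 * j + 1) + 1) := by
    rw [← pow_succ']
    congr 1
  rw [h2, pow_succ ((j : ℂ) + 1) (r + 1)]
  by_cases hY : Y = 0
  · simp [hY]
  field_simp
  ring

/-! ### The letters 0, 1, -1 and the two logarithmic weights -/

theorem admissible_zero : Admissible 0 := fun _ ht => (ofReal_ne ht).1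

theorem admissible_one : Admissible 1 := fun _ ht => sub_ne_zero.1 (ofReal_ne ht).2.1

theorem admissible_neg_one : Admissible (-1) := fun _ ht h =>
  (ofReal_ne ht).2.2 (by rw [h, neg_add_cancel])

theorem admissible_of_mem {a : ℂ} (ha : a ∈ ({0, 1} ∪ {-1} : Set ℂ)) : Admissible a := by
  rcases ha with (rfl | rfl) | rfl
  · exact admissible_zero
  · exact admissible_one
  · exact admissible_neg_one

theorem gpl_one_add_gpl_neg_one {t : ℝ} (ht : t ∈ Ioo (0 : ℝ) 1) :
    gpl [1] t + gpl [-1] t = (Real.log (1 - t ^ 2) : ℂ) := by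
  have a1 : ∀ β ∈ [(1 : ℂ)], Admissible β := by simpa using admissible_one
  have a2 : ∀ β ∈ [(-1 : ℂ)], Admissible β := by simpa using admissible_neg_one
  refine eqOn_of_hasDerivAt (F := fun t => gpl [1] t + gpl [-1] t)
    (G := fun t => (Real.log (1 - t ^ 2) : ℂ))
    (fun t ht => (gpl_hasDerivAt a1 ht).add (gpl_hasDerivAt a2 ht)) (fun t ht => ?_)
    (add_zero (0 : ℂ) ▸ (gpl_tendsto_zero a1 (by simp)).add (gpl_tendsto_zero a2 (by simp)))
    ?_ ht
  · have hne := (one_sub_sq_hasDerivAt_log ht).1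
    refine ((((hasDerivAt_pow 2 t).const_sub 1).log hne).ofReal_comp).congr_deriv ?_
    obtain ⟨-, h1, h2⟩ := ofReal_ne ht
    have h3 := one_sub_sq_ne_zero ht
    rw [gpl_nil, sub_neg_eq_add]
    push_cast
    field_simp
    ring
  · have h : ContinuousAt (fun t : ℝ => (Real.log (1 - t ^ 2) : ℂ)) 0 :=
      (Complex.continuous_ofReal.continuousAt).comp
        (ContinuousAt.log (by fun_prop) (by norm_num))
    have h2 := h.tendsto
    norm_num at h2
    exact h2.mono_left nhdsWithin_le_nhds

theorem gpl_zero_eq_log {t : ℝ} (ht : t ∈ Ioo (0 : ℝ) 1) : gpl [0] t = (Real.log t : ℂ) := by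
  rw [gpl_of_forall_eq_zero (by simp), Complex.ofReal_log ht.1.le]
  simp

/-- The weight is `2 log t` because the factor 2 clears the halves in `oddHarm n = harm (2n) - harm
n / 2`. -/
theorem betaInt_two_log (j : ℕ) : betaInt (fun t => 2 * Real.log t) (2 * j + 1) (j + 1) =
    (-harm (j + 1) + 2 * harm (2 * (j + 1)) + harm (3 * (j + 1)) - 2 * harm (6 * (j + 1))) *
      betaInt (fun _ => 1) (2 * j + 1) (j + 1) := by
  have h1 : betaInt (fun t => 2 * Real.log t) (2 * j + 1) (j + 1) =
      2 * betaInt Real.log (2 * j + 1) (j + 1) := by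
    rw [betaInt, betaInt, ← intervalIntegral.integral_const_mul]
    refine intervalIntegral.integral_congr fun t _ => ?_
    ring
  rw [h1, betaInt_log, show 2 * j + 1 + (j + 1) + 1 = 3 * (j + 1) by ring, oddHarm_eq, oddHarm_eq,
    show 2 * (3 * (j + 1)) = 6 * (j + 1) by ring]
  ring

theorem betaInt_log_one_sub_sq (j : ℕ) :
    betaInt (fun t => Real.log (1 - t ^ 2)) (2 * j + 1) (j + 1) =
    (harm (2 * (j + 1) - 1) + harm (3 * (j + 1)) - 2 * harm (6 * (j + 1)) + 2 * Real.log 2) *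
      betaInt (fun _ => 1) (2 * j + 1) (j + 1) := by
  rw [betaInt_log_one_sub, show 2 * j + 1 + (j + 1) + 1 = 3 * (j + 1) by ring, oddHarm_eq,
    show 2 * (3 * (j + 1)) = 6 * (j + 1) by ring, show 2 * (j + 1) - 1 = 2 * j + 1 by omega]
  ring

end

end GPLSeries

end

/-! ### The theorem -/

open GPLSeries in
theorem mainTheorem5 (x : ℂ) (hx : 2 / (3 * Real.sqrt 3) < ‖x * (1 - x ^ 2)‖)
    (r : ℕ) (hr : 0 < r) :
    (∀ a ∈ ({fun k : ℕ => 1 / (k : ℝ),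
          fun k : ℕ => -GPLSeries.harm k + 2 * GPLSeries.harm (2 * k) + GPLSeries.harm (3 * k)
            - 2 * GPLSeries.harm (6 * k),
          fun k : ℕ => GPLSeries.harm (2 * k - 1) + GPLSeries.harm (3 * k)
            - 2 * GPLSeries.harm (6 * k) + 2 * Real.log 2} : Set (ℕ → ℝ)),
        GPLSeries.SeriesMem a r x
          (GPLSeries.gplSpace (r + 2) (r + 1) {-1} (GPLSeries.letters x))) ∧
    (∀ (M : ℕ) (s : Fin M → ℕ), (∀ j, 0 < s j) →
        GPLSeries.SeriesMem (fun k => ∏ j, GPLSeries.genHarmonic (s j) k) r x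
          (GPLSeries.gplSpace (r + 1 + ∑ j, s j) (r + 1 + ∑ j, s j)
            ({-1} ∪ GPLSeries.letters x) (GPLSeries.letters x))) := by
  -- One power of `k` belongs to the Beta integral; `r ≥ 1` leaves the positive power `k^(r'+1)` for
  -- the polylogarithm.
  obtain ⟨r, rfl⟩ : ∃ r', r = r' + 1 := ⟨r - 1, by omega⟩
  have hA1 : ∀ a ∈ ({0, 1} ∪ {-1} : Set ℂ), Admissible a := fun a ha => admissible_of_mem ha
  have hsub1 : ({0, 1, -1} : Set ℂ) ⊆ {0, 1} ∪ {-1} := by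
    rintro a (rfl | rfl | rfl) <;> simp
  have hc := isGplSeries_one_div_pow hx hA1 hsub1 r
  refine ⟨?_, ?_⟩
  · rintro a (rfl | rfl | rfl)
    -- Here `1/k` raises the exponent instead of introducing a logarithmic weight, so the letter of
    -- `S_x` stays last (`k := 0`).
    · have hc' := isGplSeries_one_div_pow hx hA1 hsub1 (r + 1)
      refine seriesMem_of_betaInt hx hA1 rfl hc'.1 hc'.2 one_intervalIntegrable (k := 0)
        (by simpa using hc'.3) (by omega) fun j => ?_
      rw [summand_eq, pow_succ _ (r + 1)]
      push_cast
      field_simp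
    · refine seriesMem_of_betaInt hx hA1 rfl hc.1 hc.2 (log_intervalIntegrable.const_mul 2)
        (k := 1) (n := r + 2) ?_ (by omega) fun j => ?_
      · refine gplFun_congr (Submodule.smul_mem _ (2 : ℚ)
          (gpl_singleton_mul_mem hA1 (letters_admissible hx) (a := 0) (by simp) hc.3))
          fun t ht => ?_
        simp only [Pi.smul_apply, Pi.mul_apply, gpl_zero_eq_log ht, Rat.smul_def]
        push_cast
        ring
      · rw [summand_eq, betaInt_two_log]
        push_cast
        ring
    · refine seriesMem_of_betaInt hx hA1 rfl hc.1 hc.2 log_one_sub_sq_intervalIntegrable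
        (k := 1) (n := r + 2) ?_ (by omega) fun j => ?_
      · refine gplFun_congr (add_mem
          (gpl_singleton_mul_mem hA1 (letters_admissible hx) (a := 1) (by simp) hc.3)
          (gpl_singleton_mul_mem hA1 (letters_admissible hx) (a := -1) (by simp) hc.3))
          fun t ht => ?_
        simp only [Pi.add_apply, Pi.mul_apply, ← gpl_one_add_gpl_neg_one ht]
        ring
      · rw [summand_eq, betaInt_log_one_sub_sq]
        push_cast
        ring
  · intro M s hs
    have hA2 : ∀ a ∈ ({0, 1} ∪ ({-1} ∪ letters x) : Set ℂ), Admissible a := by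
      rintro a (ha | ha | ha)
      · exact hA1 a (Or.inl ha)
      · exact hA1 a (Or.inr ha)
      · exact (letters_admissible hx a ha).1
    have hc' := isGplSeries_prod_genHarmonic hx hA2
      (hsub1.trans (Set.union_subset_union_right _ Set.subset_union_left))
      (Set.subset_union_right.trans Set.subset_union_right) s hs Finset.univ r
    rw [show r + 1 + 1 + ∑ j, s j = r + 1 + ∑ j, s j + 1 by ring]
    refine seriesMem_of_betaInt hx hA2 (Or.inl rfl) hc'.1 hc'.2 one_intervalIntegrable (k := 0)
      (by simpa using hc'.3) (by omega) fun j => ?_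
    rw [summand_eq]
    push_cast
    ring
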